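/- Conventions. $\lambda$ is Lebesgue measure on $[0,1]$ and $L_p=L_p([0,1],\lambda)$ (real-valued). An *Orlicz function* is an increasing convex bijection $M:[0,\infty)\to[0,\infty)$ with $M(0)=0$ and $M(1)=1$. For $r\ge 1$, $M$ is *$r$-convex* (resp. *$r$-concave*) if $t\mapsto M(t^{1/r})$ is convex (resp. concave) on $[0,\infty)$. Nonnegative functions $f,g$ are *equivalent* on a set $S$ if there is a constant $C>0$ with $C^{-1}f\le g\le Cf$ on $S$. The Orlicz sequence space $l_M$ has norm $\|a\|_{l_M}=\inf\{\rho>0:\sum_n M(|a_n|/\rho)\le 1\}$ and unit vectors $e_k$. A sequence $(f_k)$ in $L_p$ is *equivalent in $L_p$ to the unit vector basis of $l_M$* if there is $C>0$ with $C^{-1}\|a\|_{l_M}\le\|\sum_k a_kf_k\|_{L_p}\le C\|a\|_{l_M}$ for all finitely supported real $a=(a_k)$. The distribution function of $f$ is $n_f(\tau)=\lambda\{u:|f(u)|>\tau\}$, $\tau>0$; $f$ and $g$ are *equimeasurable* if $n_f=n_g$. Put $\mathfrak m(t)=1/M^{-1}(t)$, $0<t\le 1$. Theorem 1. Let $1\le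 p<2$ and let $M$ be a $p$-convex and $2$-concave Orlicz function. Consider the conditions: (i) for some $\varepsilon>0$, $M$ is equivalent on $[0,1]$ to an Orlicz function that is $(p+\varepsilon)$-convex and $(2-\varepsilon)$-concave; (ii) whenever a sequence of independent copies (on $[0,1]$) of a mean zero random variable $f\in L_p$ is equivalent in $L_p$ to the unit vector basis of $l_M$, there is $\tau_0>0$ such that $n_f$ is equivalent to $n_{\mathfrak m}$ on $[\tau_0,\infty)$; (iii) $\mathfrak m\in L_p$, and every sequence of independent copies (on $[0,1]$) of a mean zero random variable $f\in L_p$ equimeasurable with $\mathfrak m$ is equivalent in $L_p$ to the unit vector basis of $l_M$. Then (i) and (iii) are equivalent; and if $M$ is not equivalent to $t^p$ on $[0,1]$, then (i), (ii) and (iii) are all equivalent. -/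

import Mathlib

open MeasureTheory ProbabilityTheory Set

noncomputable section

/-- An Orlicz function, with the normalization `M 1 = 1` and the requirement that `M` be a
bijection of `[0, ∞)`. Only the values on `[0, ∞)` matter. -/
structure IsOrliczFunction (M : ℝ → ℝ) : Prop where
  convexOn : ConvexOn ℝ (Ici 0) M
  strictMonoOn : StrictMonoOn M (Ici 0)
  map_zero : M 0 = 0
  map_one : M 1 = 1
  bijOn : BijOn M (Ici 0) (Ici 0)

/-- `M` is `r`-convex (`1 ≤ r`): the map `t ↦ M (t ^ (1 / r))` is convex on `[0, ∞)`. -/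
def IsPowConvex (r : ℝ) (M : ℝ → ℝ) : Prop :=
  1 ≤ r ∧ ConvexOn ℝ (Ici 0) (fun t => M (t ^ (1 / r)))

/-- `M` is `r`-concave (`1 ≤ r`): the map `t ↦ M (t ^ (1 / r))` is concave on `[0, ∞)`. -/
def IsPowConcave (r : ℝ) (M : ℝ → ℝ) : Prop :=
  1 ≤ r ∧ ConcaveOn ℝ (Ici 0) (fun t => M (t ^ (1 / r)))

/-- Equivalence of two nonnegative functions on a set `S`: `C⁻¹ f ≤ g ≤ C f` on `S`. -/
def EquivalentOn (S : Set ℝ) (f g : ℝ → ℝ) : Prop :=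
  ∃ C : ℝ, 0 < C ∧ ∀ t ∈ S, C⁻¹ * f t ≤ g t ∧ g t ≤ C * f t

/-- The (Luxemburg) norm of the Orlicz sequence space `l_M`. -/
def orliczSeqNorm (M : ℝ → ℝ) (a : ℕ → ℝ) : ℝ :=
  sInf {ρ : ℝ | 0 < ρ ∧ ∑' n, ENNReal.ofReal (M (|a n| / ρ)) ≤ 1}

/-- The sequence `F` in `L_p[0,1]` is equivalent to the unit vector basis of `l_M`: the norms of
`∑ aₖ Fₖ` in `L_p[0,1]` and of `∑ aₖ eₖ = a` in `l_M` are comparable, with constants independent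
of the finitely supported sequence `a`. -/
def EquivUnitVectorBasis (p : ℝ) (M : ℝ → ℝ) (F : ℕ → unitInterval → ℝ) : Prop :=
  ∃ C : ℝ, 0 < C ∧ ∀ a : ℕ →₀ ℝ,
    ENNReal.ofReal (C⁻¹ * orliczSeqNorm M a) ≤
        eLpNorm (fun u => ∑ k ∈ a.support, a k * F k u) (ENNReal.ofReal p) volume ∧
      eLpNorm (fun u => ∑ k ∈ a.support, a k * F k u) (ENNReal.ofReal p) volume ≤
        ENNReal.ofReal (C * orliczSeqNorm M a)

/-- The distribution function `n_f(τ) = λ {u ∈ [0,1] : |f u| > τ}`. -/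
def distrFun (f : unitInterval → ℝ) (τ : ℝ) : ℝ :=
  (volume : Measure unitInterval).real {u | τ < |f u|}

/-- `f` and `g` are equimeasurable. -/
def Equimeasurable (f g : unitInterval → ℝ) : Prop :=
  ∀ τ : ℝ, 0 < τ → distrFun f τ = distrFun g τ

/-- `f` is a mean zero random variable in `L_p[0,1]`. -/
def IsMeanZeroLp (p : ℝ) (f : unitInterval → ℝ) : Prop :=
  MemLp f (ENNReal.ofReal p) volume ∧ ∫ u, f u = 0

/-- `F` is a sequence of independent copies of `f` on `[0,1]`. -/
def IsIndepCopies (f : unitInterval → ℝ) (F : ℕ → unitInterval → ℝ) : Prop :=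
  iIndepFun F volume ∧ ∀ k, IdentDistrib (F k) f volume volume

/-- The function `𝔪 = 1 / M⁻¹` on `[0,1]`, where `M⁻¹` is the inverse of the bijection
`M : [0, ∞) → [0, ∞)`. -/
def invRecip (M : ℝ → ℝ) (u : unitInterval) : ℝ :=
  1 / Function.invFunOn M (Ici 0) (u : ℝ)

/-- `M` is, up to equivalence on `[0,1]`, a `(p+ε)`-convex and `(2-ε)`-concave Orlicz function for
some `ε > 0`. -/
def IsStrictlyBetween (p : ℝ) (M : ℝ → ℝ) : Prop :=
  ∃ ε : ℝ, 0 < ε ∧ ∃ N : ℝ → ℝ, IsOrliczFunction N ∧ EquivalentOn (Icc 0 1) M N ∧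
    IsPowConvex (p + ε) N ∧ IsPowConcave (2 - ε) N

/-- Every mean zero `f ∈ L_p[0,1]` some sequence of independent copies of which is equivalent in
`L_p` to the unit vector basis of `l_M` has a distribution function that is equivalent, for large
arguments, to that of `𝔪`. -/
def HasUniqueDistribution (p : ℝ) (M : ℝ → ℝ) : Prop :=
  ∀ (f : unitInterval → ℝ) (F : ℕ → unitInterval → ℝ),
    IsMeanZeroLp p f → IsIndepCopies f F → EquivUnitVectorBasis p M F →
      ∃ τ₀ : ℝ, 0 < τ₀ ∧ EquivalentOn (Ici τ₀) (distrFun f) (distrFun (invRecip M))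

/-- `𝔪 ∈ L_p[0,1]`, and every sequence of independent copies of a mean zero random variable
equimeasurable with `𝔪` is equivalent in `L_p` to the unit vector basis of `l_M`. -/
def InvRecipSpans (p : ℝ) (M : ℝ → ℝ) : Prop :=
  MemLp (invRecip M) (ENNReal.ofReal p) volume ∧
    ∀ (f : unitInterval → ℝ) (F : ℕ → unitInterval → ℝ),
      IsMeanZeroLp p f → Equimeasurable f (invRecip M) → IsIndepCopies f F →
        EquivUnitVectorBasis p M F

end

/-!
Put `ψ(t) = (1 + t ^ 2) ^ (p / 2) - 1`, which is comparable with `min (t ^ 2) (|t| ^ p)`, and let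
`Φ_f(s) = E ψ(s f)` (`psi` and `modular` below).

*Independent copies.* For independent mean zero `Y_k` the numbers `E ψ(∑ Y_k)` and `∑ E ψ(Y_k)`
are comparable as long as the former is small. Both bounds come from the Taylor remainder
`ψ(x + y) - ψ(x) - ψ'(x) y`, whose middle term integrates to zero: it is at most `15 ψ(y)`
(`psi_add_le`), it is nonnegative, and it is at least `ψ(y) / 144` when `|x| ≤ 1`
(`psi_strong_convex`); if `E ψ(∑ Y_k)` is small then every partial sum lies in `[-1, 1]` with
probability at least `1/2`. Hence independent copies of `f` are equivalent in `L_p` to the basis of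
`l_M` exactly when `Φ_f` is equivalent to `M` on `[0, 1]`
(`equivUnitVectorBasis_of_equivalentOn`, `equivalentOn_of_equivUnitVectorBasis`).

*The gap condition.* With `R(s) = M(s) / s ^ p`, which is nondecreasing, and `T(s) = M(s) / s ^ 2`,
which is nonincreasing, `IsStrictlyBetween p M` amounts to the existence of a step `A > 1` with
`R(s) ≤ R(A s) / 2` and `T(A s) ≤ T(s) / 2` for small `s` (`PowGap`). For the nontrivial direction
one sums the values `M(A ^ (-j))` against dilates of a kernel which is `(p + ε)`-convex and
`(2 - ε)`-concave (`PowGap.isStrictlyBetween`).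

*Conclusion.* The tail of `𝔪 = 1 / M⁻¹` is `M(1 / τ)`. Under the gap condition the contributions to
`Φ_f(s)` of the layers of values of `|f|` decay geometrically away from `1 / s`; therefore
`Φ_𝔪` is equivalent to `M` (`PowGap.invRecipSpans`), and conversely `Φ_f ~ M` determines the tail
of `f` (`hasUniqueDistribution_of_powGap`). If `Φ_𝔪 ≤ C M`, adding up the contributions of many
dyadic layers gives the gap condition (`powGap_of_modular_le`). Finally, if `M` is not equivalent
to `t ^ p`, there is a sparse sequence of levels `x_j` with `M(s) ~ ∑ M(1 / x_j) ψ(s x_j)`, so that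
a symmetric variable with values `± x_j` has `Φ_f ~ M`; if its tail is also equivalent to
`M(1 / τ)`, the levels cannot be too sparse, and the gap condition follows
(`HasUniqueDistribution.powGap`).
-/

/-! ### The truncated power kernels -/

/-- The concave function `u ↦ (1 + u) ^ θ - 1` on `[0, ∞)`; for `θ ∈ [1/2, 1]` it is a smooth
substitute for `min u (u ^ θ)`. -/
noncomputable def shiftPow (θ u : ℝ) : ℝ := (1 + u) ^ θ - 1

lemma shiftPow_nonneg {θ u : ℝ} (hθ : 0 ≤ θ) (hu : 0 ≤ u) : 0 ≤ shiftPow θ u := by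
  have := Real.one_le_rpow (x := 1 + u) (by linarith) hθ
  unfold shiftPow; linarith

lemma shiftPow_mono {θ u v : ℝ} (hθ : 0 ≤ θ) (hu : 0 ≤ u) (huv : u ≤ v) :
    shiftPow θ u ≤ shiftPow θ v := by
  have := Real.rpow_le_rpow (x := 1 + u) (y := 1 + v) (by linarith) (by linarith) hθ
  unfold shiftPow; linarith

lemma shiftPow_le_self {θ u : ℝ} (hθ : 0 ≤ θ) (hθ1 : θ ≤ 1) (hu : 0 ≤ u) : shiftPow θ u ≤ u := by
  have := rpow_one_add_le_one_add_mul_self (s := u) (by linarith) hθ hθ1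
  have : θ * u ≤ 1 * u := by gcongr
  unfold shiftPow; linarith

lemma shiftPow_le_rpow {θ u : ℝ} (hθ : 0 ≤ θ) (hθ1 : θ ≤ 1) (hu : 0 ≤ u) :
    shiftPow θ u ≤ u ^ θ := by
  have := Real.rpow_add_le_add_rpow (a := 1) (b := u) zero_le_one hu hθ hθ1
  rw [Real.one_rpow] at this
  unfold shiftPow; linarith

lemma seven_fifths_le_two_rpow {θ : ℝ} (hθ : 1 / 2 ≤ θ) : (7 / 5 : ℝ) ≤ 2 ^ θ := by
  calc (7 / 5 : ℝ) ≤ √2 := by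
        apply Real.le_sqrt_of_sq_le; norm_num
    _ = 2 ^ (1 / 2 : ℝ) := Real.sqrt_eq_rpow 2
    _ ≤ 2 ^ θ := Real.rpow_le_rpow_of_exponent_le (by norm_num) hθ

lemma min_le_shiftPow {θ u : ℝ} (hθ : 1 / 2 ≤ θ) (hθ1 : θ ≤ 1) (hu : 0 ≤ u) :
    min u (u ^ θ) ≤ 5 / 2 * shiftPow θ u := by
  have hconc := Real.concaveOn_rpow (p := θ) (by linarith) hθ1
  have h2 := seven_fifths_le_two_rpow hθ
  unfold shiftPow
  rcases le_total u 1 with h | h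
  · refine (min_le_left _ _).trans ?_
    have := hconc.2 (by simp : (1 : ℝ) ∈ Ici 0) (by simp : (2 : ℝ) ∈ Ici 0)
      (by linarith : 0 ≤ 1 - u) hu (by ring)
    simp only [smul_eq_mul, Real.one_rpow] at this
    rw [show (1 - u) * 1 + u * 2 = 1 + u by ring] at this
    nlinarith
  · refine (min_le_right _ _).trans ?_
    have := hconc.2 (by simp : (1 : ℝ) ∈ Ici 0) (mem_Ici.2 hu)
      (by norm_num : (0 : ℝ) ≤ 1 / 2) (by norm_num : (0 : ℝ) ≤ 1 / 2) (by norm_num)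
    simp only [smul_eq_mul, Real.one_rpow] at this
    rw [show (1 / 2 : ℝ) * 1 + 1 / 2 * u = (1 + u) / 2 by ring,
      Real.div_rpow (by linarith) (by norm_num), le_div_iff₀ (by positivity)] at this
    have hv : 1 ≤ u ^ θ := Real.one_le_rpow h (by linarith)
    nlinarith

/-- The even convex function `t ↦ (1 + t ^ 2) ^ (p / 2) - 1`, comparable with
`min (t ^ 2) (|t| ^ p)` when `1 ≤ p ≤ 2`. -/
noncomputable def psi (p t : ℝ) : ℝ := shiftPow (p / 2) (t ^ 2)

/-- The derivative of `psi p`. -/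
noncomputable def dpsi (p t : ℝ) : ℝ := p * t * (1 + t ^ 2) ^ (p / 2 - 1)

lemma psi_eq (p t : ℝ) : psi p t = (1 + t ^ 2) ^ (p / 2) - 1 := rfl

lemma sq_rpow_half (p t : ℝ) : (t ^ 2) ^ (p / 2) = |t| ^ p := by
  rw [← sq_abs, ← Real.rpow_natCast, ← Real.rpow_mul (abs_nonneg t)]
  congr 1; push_cast; ring

lemma psi_abs (p t : ℝ) : psi p |t| = psi p t := by simp [psi]

lemma psi_zero (p : ℝ) : psi p 0 = 0 := by simp [psi, shiftPow]

lemma measurable_psi (p : ℝ) : Measurable (psi p) := by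
  unfold psi shiftPow; fun_prop

lemma measurable_dpsi (p : ℝ) : Measurable (dpsi p) := by
  unfold dpsi; fun_prop

lemma psi_nonneg {p : ℝ} (hp1 : 1 ≤ p) (t : ℝ) :
    0 ≤ psi p t := shiftPow_nonneg (by linarith) (sq_nonneg t)

lemma psi_mono {p : ℝ} (hp1 : 1 ≤ p) {s t : ℝ} (h : |s| ≤ |t|) : psi p s ≤ psi p t :=
  shiftPow_mono (by linarith) (sq_nonneg s) (sq_le_sq.2 h)

lemma psi_le_sq {p : ℝ} (hp1 : 1 ≤ p) (hp2 : p ≤ 2) (t : ℝ) : psi p t ≤ t ^ 2 :=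
  shiftPow_le_self (by linarith) (by linarith) (sq_nonneg t)

lemma psi_le_rpow {p : ℝ} (hp1 : 1 ≤ p) (hp2 : p ≤ 2) (t : ℝ) : psi p t ≤ |t| ^ p := by
  rw [← sq_rpow_half]
  exact shiftPow_le_rpow (by linarith) (by linarith) (sq_nonneg t)

lemma min_le_psi {p : ℝ} (hp1 : 1 ≤ p) (hp2 : p ≤ 2) (t : ℝ) :
    min (t ^ 2) (|t| ^ p) ≤ 5 / 2 * psi p t := by
  rw [← sq_rpow_half]
  exact min_le_shiftPow (by linarith) (by linarith) (sq_nonneg t)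

lemma rpow_le_psi_add_one {p : ℝ} (hp1 : 1 ≤ p) (t : ℝ) : |t| ^ p ≤ psi p t + 1 := by
  rw [psi_eq, ← sq_rpow_half]
  have := Real.rpow_le_rpow (x := t ^ 2) (y := 1 + t ^ 2) (z := p / 2) (sq_nonneg t) (by linarith)
    (by linarith)
  linarith

lemma sq_le_psi {p : ℝ} (hp1 : 1 ≤ p) (hp2 : p ≤ 2) {t : ℝ} (ht : |t| ≤ 1) :
    t ^ 2 ≤ 5 / 2 * psi p t := by
  refine le_trans (le_of_eq ?_) (min_le_psi hp1 hp2 t)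
  rw [min_eq_left]
  rw [← sq_abs, ← Real.rpow_natCast]
  exact Real.rpow_le_rpow_of_exponent_ge' (abs_nonneg t) ht (by linarith) (by exact_mod_cast hp2)

lemma rpow_le_psi {p : ℝ} (hp1 : 1 ≤ p) (hp2 : p ≤ 2) {t : ℝ} (ht : 1 ≤ |t|) :
    |t| ^ p ≤ 5 / 2 * psi p t := by
  refine le_trans (le_of_eq ?_) (min_le_psi hp1 hp2 t)
  rw [min_eq_right]
  rw [← sq_abs t, ← Real.rpow_natCast]
  exact Real.rpow_le_rpow_of_exponent_le ht (by exact_mod_cast hp2)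

lemma one_le_psi {p : ℝ} (hp1 : 1 ≤ p) (hp2 : p ≤ 2) {t : ℝ} (ht : 1 ≤ |t|) : 1 ≤ 5 / 2 * psi p t :=
  (Real.one_le_rpow ht (by linarith)).trans (rpow_le_psi hp1 hp2 ht)

lemma psi_mul_le {p : ℝ} (hp1 : 1 ≤ p) (hp2 : p ≤ 2) {l : ℝ} (hl : 1 ≤ l) (t : ℝ) :
    psi p (l * t) ≤ 5 / 2 * l ^ 2 * psi p t := by
  have h1 := psi_le_sq hp1 hp2 (l * t)
  have h2 := psi_le_rpow hp1 hp2 (l * t)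
  rcases le_total |t| 1 with h | h
  · have := sq_le_psi hp1 hp2 h
    nlinarith [sq_nonneg l]
  · have := rpow_le_psi hp1 hp2 h
    rw [abs_mul, Real.mul_rpow (abs_nonneg _) (abs_nonneg _), abs_of_nonneg (by linarith)] at h2
    have h3 : l ^ p ≤ l ^ 2 := by
      rw [← Real.rpow_natCast]
      exact Real.rpow_le_rpow_of_exponent_le hl (by exact_mod_cast hp2)
    have h4 : 0 ≤ |t| ^ p := by positivity
    nlinarith [sq_nonneg l]

lemma psi_mul_le_rpow {p : ℝ} (hp1 : 1 ≤ p) (hp2 : p ≤ 2) {l : ℝ} (hl : 0 ≤ l) {t : ℝ} (ht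
    : 1 ≤ |t|) :
    psi p (l * t) ≤ 5 / 2 * l ^ p * psi p t := by
  have h2 := psi_le_rpow hp1 hp2 (l * t)
  have := rpow_le_psi hp1 hp2 ht
  rw [abs_mul, Real.mul_rpow (abs_nonneg _) (abs_nonneg _), abs_of_nonneg hl] at h2
  have h3 : 0 ≤ l ^ p := by positivity
  nlinarith

lemma psi_mul_le_sq {p : ℝ} (hp1 : 1 ≤ p) (hp2 : p ≤ 2) {l : ℝ} {t : ℝ} (ht : |t| ≤ 1) :
    psi p (l * t) ≤ 5 / 2 * l ^ 2 * psi p t := by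
  have h1 := psi_le_sq hp1 hp2 (l * t)
  have := sq_le_psi hp1 hp2 ht
  nlinarith [sq_nonneg l]

/-- The first-order Taylor remainder of `psi` at any point is controlled by `psi` of the
increment. -/
lemma psi_add_le {p : ℝ} (hp1 : 1 ≤ p) (hp2 : p ≤ 2) (x y : ℝ) :
    psi p (x + y) ≤ psi p x + dpsi p x * y + 15 * psi p y := by
  have hmin := min_le_psi hp1 hp2 y
  set w := (1 + x ^ 2) ^ (p / 2 - 1) with hw
  have hw0 : 0 ≤ w := by positivity
  have hx1 : 1 ≤ 1 + x ^ 2 := by nlinarith [sq_nonneg x]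
  have hw1 : w ≤ 1 := Real.rpow_le_one_of_one_le_of_nonpos hx1 (by linarith)
  have hwx : (1 + x ^ 2) ^ (p / 2) = w * (1 + x ^ 2) := by
    rw [hw, ← Real.rpow_add_one (by positivity)]; congr 1; ring
  have htan : psi p (x + y) ≤ psi p x + dpsi p x * y + p / 2 * w * y ^ 2 := by
    -- Bernoulli's inequality applied to `(1 + (x + y) ^ 2) / (1 + x ^ 2)`
    have hb := rpow_one_add_le_one_add_mul_self (s := (2 * x * y + y ^ 2) / (1 + x ^ 2))
      (p := p / 2) (by rw [le_div_iff₀ (by positivity)]; nlinarith [sq_nonneg (x + y)])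
      (by linarith) (by linarith)
    have he : 1 + (x + y) ^ 2 = (1 + x ^ 2) * (1 + (2 * x * y + y ^ 2) / (1 + x ^ 2)) := by
      field_simp; ring
    rw [psi_eq, psi_eq, he, Real.mul_rpow (by positivity), hwx, dpsi, ← hw]
    · have := mul_le_mul_of_nonneg_left hb (a := w * (1 + x ^ 2)) (by positivity)
      have h3 : w * (1 + x ^ 2) * (1 + p / 2 * ((2 * x * y + y ^ 2) / (1 + x ^ 2)))
          = w * (1 + x ^ 2) + w * (p / 2) * (2 * x * y + y ^ 2) := by
        field_simp
      nlinarith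
    · have : 1 + (2 * x * y + y ^ 2) / (1 + x ^ 2) = (1 + (x + y) ^ 2) / (1 + x ^ 2) := by
        field_simp; ring
      rw [this]; positivity
  -- this settles all `y` but large ones with `|x| < |y|`, where crude bounds suffice
  have hsmall : p / 2 * w * y ^ 2 ≤ w * y ^ 2 := by
    have : 0 ≤ w * y ^ 2 := by positivity
    nlinarith
  have hy2 : w * y ^ 2 ≤ y ^ 2 := by nlinarith [sq_nonneg y]
  have hpsi := psi_nonneg hp1 y
  rcases le_total |y| 1 with h1 | h1
  · have := sq_le_psi hp1 hp2 h1
    linarith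
  · have hyp := rpow_le_psi hp1 hp2 h1
    have hy0 : 0 < |y| := by linarith
    rcases le_total |y| |x| with h | h
    · have : w * y ^ 2 ≤ |y| ^ p := by
        have h5 : w ≤ (y ^ 2) ^ (p / 2 - 1) :=
          Real.rpow_le_rpow_of_nonpos (by rw [← sq_abs]; positivity)
            (by nlinarith [sq_le_sq.2 h]) (by linarith)
        calc w * y ^ 2 ≤ (y ^ 2) ^ (p / 2 - 1) * y ^ 2 := by gcongr
          _ = |y| ^ p := by
            rw [← Real.rpow_add_one (by rw [← sq_abs]; positivity), ← sq_rpow_half]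
            congr 1; ring
      linarith
    · have hxy : |x + y| ≤ 2 * |y| := (abs_add_le x y).trans (by linarith)
      have h6 : psi p (x + y) ≤ 4 * |y| ^ p := by
        refine (psi_le_rpow hp1 hp2 _).trans ?_
        calc |x + y| ^ p ≤ (2 * |y|) ^ p := by gcongr
          _ = 2 ^ p * |y| ^ p := Real.mul_rpow (by norm_num) (abs_nonneg _)
          _ ≤ 2 ^ (2 : ℝ) * |y| ^ p := by gcongr; norm_num
          _ = 4 * |y| ^ p := by norm_num
      have h7 : -(dpsi p x * y) ≤ 2 * |y| ^ p := by
        refine (neg_le_abs _).trans ?_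
        rw [dpsi, ← hw, abs_mul, abs_mul, abs_mul, abs_of_nonneg hw0,
          abs_of_nonneg (by linarith : (0 : ℝ) ≤ p)]
        have h8 : |x| * w ≤ |y| ^ (p - 1) := by
          rcases eq_or_ne x 0 with rfl | hx
          · simp; positivity
          · have hx0 : 0 < |x| := abs_pos.2 hx
            calc |x| * w ≤ |x| * (x ^ 2) ^ (p / 2 - 1) := by
                  gcongr |x| * ?_
                  exact Real.rpow_le_rpow_of_nonpos (by positivity) (by linarith) (by linarith)
              _ = |x| ^ (p - 1) := by
                  rw [show p / 2 - 1 = (p - 2) / 2 by ring, sq_rpow_half, mul_comm,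
                    ← Real.rpow_add_one hx0.ne']
                  congr 1; ring
              _ ≤ |y| ^ (p - 1) := by gcongr
        have h9 : |y| ^ (p - 1) * |y| = |y| ^ p := by
          rw [← Real.rpow_add_one hy0.ne']; congr 1; ring
        have h10 : 0 ≤ |x| * w := by positivity
        calc p * |x| * w * |y| = p * ((|x| * w) * |y|) := by ring
          _ ≤ 2 * (|y| ^ (p - 1) * |y|) := by gcongr
          _ = 2 * |y| ^ p := by rw [h9]
      have := psi_nonneg hp1 x
      linarith

/-- The graph of `g ↦ g ^ p` lies above its tangent line at `a`. -/
lemma rpow_bernoulli {p : ℝ} (hp1 : 1 ≤ p) {g a : ℝ} (hg : 0 ≤ g) (ha : 0 < a) :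
    a ^ p + p * a ^ (p - 1) * (g - a) ≤ g ^ p := by
  have hb := one_add_mul_self_le_rpow_one_add (s := g / a - 1)
    (by have : 0 ≤ g / a := by positivity
        linarith) hp1
  rw [show 1 + (g / a - 1) = g / a by ring, Real.div_rpow hg ha.le, le_div_iff₀ (by positivity)]
    at hb
  have : a ^ p = a ^ (p - 1) * a := by
    rw [← Real.rpow_add_one ha.ne']; congr 1; ring
  refine le_trans (le_of_eq ?_) hb
  rw [this]; field_simp

/-- With `a = √(1 + x ^ 2)` and `g = √(1 + (x + y) ^ 2)`, the Taylor remainder of `psi` splits into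
that of `g ↦ g ^ p` at `a` and a multiple of the gap `D` between `g` and the tangent line of
`z ↦ √(1 + z ^ 2)` at `x`. -/
lemma psi_taylor_remainder (p x y : ℝ) : ∃ a g D : ℝ, 1 ≤ a ∧ a ^ 2 = 1 + x ^ 2 ∧ 1 ≤ g ∧
    g ^ 2 = 1 + (x + y) ^ 2 ∧ y ^ 2 ≤ 2 * a ^ 2 * g * D ∧ 0 ≤ D ∧
    psi p (x + y) - psi p x - dpsi p x * y =
      g ^ p - a ^ p - p * a ^ (p - 1) * (g - a) + p * a ^ (p - 1) * D := by
  set a := √(1 + x ^ 2)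
  set g := √(1 + (x + y) ^ 2)
  have ha : a ^ 2 = 1 + x ^ 2 := Real.sq_sqrt (by positivity)
  have hg : g ^ 2 = 1 + (x + y) ^ 2 := Real.sq_sqrt (by positivity)
  have ha1 : 1 ≤ a := Real.one_le_sqrt.2 (by nlinarith [sq_nonneg x])
  have hg1 : 1 ≤ g := Real.one_le_sqrt.2 (by nlinarith [sq_nonneg (x + y)])
  have ha0 : 0 < a := by linarith
  -- the gap between `√(1 + z ^ 2)` and its tangent line is explicit
  have hagle : 1 + x * (x + y) ≤ a * g := by
    refine (abs_le_of_sq_le_sq' (?_ : _ ≤ (a * g) ^ 2) (by positivity)).2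
    rw [mul_pow, ha, hg]
    nlinarith [sq_nonneg y]
  refine ⟨a, g, g - (1 + x * (x + y)) / a, ha1, ha, hg1, hg, ?_, ?_, ?_⟩
  · have h1 : 2 * a ^ 2 * g * (g - (1 + x * (x + y)) / a)
        = 2 * (a * g) * (a * g - (1 + x * (x + y))) := by field_simp
    have h2 : (a * g) ^ 2 = (1 + x ^ 2) * (1 + (x + y) ^ 2) := by rw [mul_pow, ha, hg]
    rw [h1]
    nlinarith
  · rw [sub_nonneg, div_le_iff₀ ha0]; linarith
  · have h1 : (1 + x ^ 2) ^ (p / 2) = a ^ p := by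
      rw [← ha, sq_rpow_half, abs_of_pos ha0]
    have h2 : (1 + (x + y) ^ 2) ^ (p / 2) = g ^ p := by
      rw [← hg, sq_rpow_half, abs_of_pos (by linarith)]
    have h3 : (1 + x ^ 2) ^ (p / 2 - 1) = a ^ (p - 2) := by
      rw [← ha, show p / 2 - 1 = (p - 2) / 2 by ring, sq_rpow_half, abs_of_pos ha0]
    have h4 : a ^ (p - 1) = a ^ (p - 2) * a := by
      rw [← Real.rpow_add_one ha0.ne']; congr 1; ring
    rw [psi_eq, psi_eq, dpsi, h1, h2, h3, h4]
    field_simp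
    linear_combination (-p * a ^ (p - 2)) * ha

lemma psi_tangent_le {p : ℝ} (hp1 : 1 ≤ p) (x y : ℝ) : psi p x + dpsi p x * y ≤ psi p (x + y) := by
  obtain ⟨a, g, D, ha, -, hg, -, -, hD, h⟩ := psi_taylor_remainder p x y
  have := rpow_bernoulli hp1 (g := g) (a := a) (by linarith) (by linarith)
  have h2 : 0 ≤ p * a ^ (p - 1) * D := by positivity
  linarith

/-- Strong convexity of `psi` near the origin: for `|x| ≤ 1` the Taylor remainder at `x` is
bounded below by `psi` of the increment. -/
lemma psi_strong_convex {p : ℝ} (hp1 : 1 ≤ p) (hp2 : p ≤ 2) {x : ℝ} (hx : |x| ≤ 1) (y : ℝ) :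
    psi p x + dpsi p x * y + psi p y / 144 ≤ psi p (x + y) := by
  obtain ⟨a, g, D, ha, ha2, hg, hg2, hyD, hD, h⟩ := psi_taylor_remainder p x y
  have hx2 : x ^ 2 ≤ 1 := by rw [← sq_abs]; nlinarith [abs_nonneg x]
  have hB := rpow_bernoulli hp1 (g := g) (a := a) (by linarith) (by linarith)
  have haD : D ≤ p * a ^ (p - 1) * D := by
    have := Real.one_le_rpow ha (by linarith : 0 ≤ p - 1)
    have : 1 ≤ p * a ^ (p - 1) := by nlinarith
    nlinarith
  have hyD2 : y ^ 2 ≤ 4 * g * D := by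
    have : 0 ≤ g * D := by positivity
    nlinarith
  have hgle : g ≤ 2 + |y| := by
    apply abs_le_of_sq_le_sq' _ (by positivity) |>.2
    rw [hg2]
    have h1 := abs_add_le x y
    have h2 : (x + y) ^ 2 ≤ (1 + |y|) ^ 2 := by
      rw [← sq_abs (x + y)]; gcongr; linarith
    nlinarith [abs_nonneg y]
  rcases le_total |y| 1 with hy | hy
  · have := psi_le_sq hp1 hp2 y
    have : y ^ 2 ≤ 12 * D := by nlinarith
    nlinarith [sq_nonneg y]
  · have hyg : |y| ≤ 2 * g := by
      have h1 : |x + y| ≤ g := by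
        apply abs_le_of_sq_le_sq _ (by linarith)
        linarith
      have h2 : |y| ≤ |x + y| + |x| := by
        have := abs_sub (x + y) x
        simpa using this
      linarith
    have hD36 : g ≤ 36 * D := by
      have h1 : |y| ^ 2 ≤ 12 * |y| * D := by
        rw [sq_abs]
        have : g * D ≤ 3 * |y| * D := by gcongr; linarith
        linarith
      have : |y| ≤ 12 * D := by nlinarith
      linarith
    have hpsi : psi p y ≤ 4 * g ^ p := by
      refine (psi_le_rpow hp1 hp2 _).trans ?_
      calc |y| ^ p ≤ (2 * g) ^ p := by gcongr
          _ = 2 ^ p * g ^ p := Real.mul_rpow (by norm_num) (by linarith)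
          _ ≤ 2 ^ (2 : ℝ) * g ^ p := by gcongr; norm_num
          _ = 4 * g ^ p := by norm_num
    set q := p * a ^ (p - 1) with hq
    have hq0 : 0 ≤ q := by positivity
    have hqa : a ^ p ≤ q * a := by
      have : a ^ p = a ^ (p - 1) * a := by
        rw [← Real.rpow_add_one (by linarith)]; congr 1; ring
      rw [this, hq]
      have : 0 ≤ a ^ (p - 1) * a := by positivity
      nlinarith
    have hqD : q * g ≤ 36 * (q * D) := by nlinarith
    linarith

/-! ### Moments of sums of independent mean zero variables -/

lemma abs_dpsi_le {p : ℝ} (hp1 : 1 ≤ p) (hp2 : p ≤ 2) (t : ℝ) : |dpsi p t| ≤ 2 * |t| := by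
  have h0 : 0 ≤ (1 + t ^ 2) ^ (p / 2 - 1) := by positivity
  have h1 : (1 + t ^ 2) ^ (p / 2 - 1) ≤ 1 :=
    Real.rpow_le_one_of_one_le_of_nonpos (by nlinarith [sq_nonneg t]) (by linarith)
  rw [dpsi, abs_mul, abs_mul, abs_of_nonneg h0, abs_of_nonneg (by linarith : (0 : ℝ) ≤ p)]
  calc p * |t| * (1 + t ^ 2) ^ (p / 2 - 1) ≤ 2 * |t| * 1 := by gcongr
    _ = 2 * |t| := by ring

section
variable {Ω : Type*} {mΩ : MeasurableSpace Ω} {μ : Measure Ω} {p : ℝ}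

lemma integrable_abs_rpow (hp1 : 1 ≤ p) {X : Ω → ℝ} (hX : MemLp X (ENNReal.ofReal p) μ) :
    Integrable (fun ω => |X ω| ^ p) μ := by
  have := hX.integrable_norm_rpow (by simp; linarith) (by simp)
  rwa [ENNReal.toReal_ofReal (by linarith)] at this

lemma integral_psi_nonneg (hp1 : 1 ≤ p) (X : Ω → ℝ) : 0 ≤ ∫ ω, psi p (X ω) ∂μ :=
  integral_nonneg fun _ => psi_nonneg hp1 _

lemma integrable_psi (hp1 : 1 ≤ p) (hp2 : p ≤ 2) {X : Ω → ℝ}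
    (hX : MemLp X (ENNReal.ofReal p) μ) : Integrable (fun ω => psi p (X ω)) μ := by
  refine (integrable_abs_rpow hp1 hX).mono'
    ((measurable_psi p).comp_aemeasurable hX.1.aemeasurable).aestronglyMeasurable
    (Filter.Eventually.of_forall fun ω => ?_)
  rw [Real.norm_of_nonneg (psi_nonneg hp1 _)]
  exact psi_le_rpow hp1 hp2 _

variable [IsProbabilityMeasure μ]

lemma memLp_integrable (hp1 : 1 ≤ p) {X : Ω → ℝ} (hX : MemLp X (ENNReal.ofReal p) μ) :
    Integrable X μ :=
  hX.integrable (by rw [← ENNReal.ofReal_one]; exact ENNReal.ofReal_le_ofReal hp1)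

lemma integrable_dpsi (hp1 : 1 ≤ p) (hp2 : p ≤ 2) {X : Ω → ℝ}
    (hX : MemLp X (ENNReal.ofReal p) μ) : Integrable (fun ω => dpsi p (X ω)) μ := by
  refine ((memLp_integrable hp1 hX).abs.const_mul 2).mono'
    ((measurable_dpsi p).comp_aemeasurable hX.1.aemeasurable).aestronglyMeasurable
    (Filter.Eventually.of_forall fun ω => abs_dpsi_le hp1 hp2 _)

lemma integrable_dpsi_mul (hp1 : 1 ≤ p) (hp2 : p ≤ 2) {X Y : Ω → ℝ}
    (hX : MemLp X (ENNReal.ofReal p) μ) (hY : MemLp Y (ENNReal.ofReal p) μ)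
    (hXY : IndepFun X Y μ) : Integrable (fun ω => dpsi p (X ω) * Y ω) μ :=
  (hXY.comp (measurable_dpsi p) measurable_id).integrable_mul (integrable_dpsi hp1 hp2 hX)
    (memLp_integrable hp1 hY)

lemma integral_dpsi_mul (hp1 : 1 ≤ p) (hp2 : p ≤ 2) {X Y : Ω → ℝ}
    (hX : MemLp X (ENNReal.ofReal p) μ) (hY : MemLp Y (ENNReal.ofReal p) μ)
    (hXY : IndepFun X Y μ) (hY0 : ∫ ω, Y ω ∂μ = 0) :
    ∫ ω, dpsi p (X ω) * Y ω ∂μ = 0 := by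
  have := (hXY.comp (measurable_dpsi p) measurable_id).integral_fun_mul_eq_mul_integral
    (integrable_dpsi hp1 hp2 hX).1 (memLp_integrable hp1 hY).1
  simpa [Function.comp_def, hY0] using this

lemma integral_psi_add_le (hp1 : 1 ≤ p) (hp2 : p ≤ 2) {X Y : Ω → ℝ}
    (hX : MemLp X (ENNReal.ofReal p) μ) (hY : MemLp Y (ENNReal.ofReal p) μ)
    (hXY : IndepFun X Y μ) (hY0 : ∫ ω, Y ω ∂μ = 0) :
    ∫ ω, psi p (X ω + Y ω) ∂μ ≤ ∫ ω, psi p (X ω) ∂μ + 15 * ∫ ω, psi p (Y ω) ∂μ := by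
  have h1 := integrable_psi hp1 hp2 hX
  have h2 := integrable_dpsi_mul hp1 hp2 hX hY hXY
  have h3 := (integrable_psi hp1 hp2 hY).const_mul 15
  have h := integral_mono (integrable_psi hp1 hp2 (hX.add hY)) ((h1.add h2).add h3)
    fun ω => psi_add_le hp1 hp2 (X ω) (Y ω)
  simp only [Pi.add_apply] at h
  rw [integral_add (by exact h1.add h2) h3, integral_add h1 h2,
    integral_dpsi_mul hp1 hp2 hX hY hXY hY0, integral_const_mul] at h
  linarith

/-- Adding an independent mean zero variable does not decrease `E ψ`. -/
lemma integral_psi_le_add (hp1 : 1 ≤ p) (hp2 : p ≤ 2) {X Y : Ω → ℝ}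
    (hX : MemLp X (ENNReal.ofReal p) μ) (hY : MemLp Y (ENNReal.ofReal p) μ)
    (hXY : IndepFun X Y μ) (hY0 : ∫ ω, Y ω ∂μ = 0) :
    ∫ ω, psi p (X ω) ∂μ ≤ ∫ ω, psi p (X ω + Y ω) ∂μ := by
  have h1 := integrable_psi hp1 hp2 hX
  have h2 := integrable_dpsi_mul hp1 hp2 hX hY hXY
  have h := integral_mono (h1.add h2) (integrable_psi hp1 hp2 (hX.add hY))
    fun ω => psi_tangent_le hp1 (X ω) (Y ω)
  simp only [Pi.add_apply] at h
  rw [integral_add h1 h2, integral_dpsi_mul hp1 hp2 hX hY hXY hY0] at h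
  linarith

/-- If `X` is small with probability at least `1/2`, then adding an independent mean zero `Y`
increases `E ψ(X)` by at least a multiple of `E ψ(Y)`. -/
lemma integral_psi_add_ge (hp1 : 1 ≤ p) (hp2 : p ≤ 2) {X Y : Ω → ℝ}
    (hX : MemLp X (ENNReal.ofReal p) μ) (hY : MemLp Y (ENNReal.ofReal p) μ)
    (hXY : IndepFun X Y μ) (hY0 : ∫ ω, Y ω ∂μ = 0) (hX5 : ∫ ω, psi p (X ω) ∂μ ≤ 1 / 5) :
    ∫ ω, psi p (X ω) ∂μ + (∫ ω, psi p (Y ω) ∂μ) / 288 ≤ ∫ ω, psi p (X ω + Y ω) ∂μ := by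
  have h1 := integrable_psi hp1 hp2 hX
  have h2 := integrable_dpsi_mul hp1 hp2 hX hY hXY
  have hYi := integrable_psi hp1 hp2 hY
  -- `φ` is a lower bound for the indicator of `|t| ≤ 1`
  set φ : ℝ → ℝ := fun t => 1 - 5 / 2 * psi p t with hφ
  have hφm : Measurable φ := by
    have := measurable_psi p
    fun_prop
  have hφi : Integrable (fun ω => φ (X ω)) μ := (integrable_const 1).sub (h1.const_mul _)
  have hind := hXY.comp hφm (measurable_psi p)
  have h3 : Integrable (fun ω => φ (X ω) * psi p (Y ω)) μ := hind.integrable_mul hφi hYi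
  have h4 : ∫ ω, φ (X ω) * psi p (Y ω) ∂μ = (∫ ω, φ (X ω) ∂μ) * ∫ ω, psi p (Y ω) ∂μ :=
    hind.integral_fun_mul_eq_mul_integral hφi.1 hYi.1
  have h5 : (1 / 2 : ℝ) ≤ ∫ ω, φ (X ω) ∂μ := by
    simp only [hφ]
    rw [integral_sub (integrable_const 1) (h1.const_mul _), integral_const_mul]
    simp only [integral_const, probReal_univ, smul_eq_mul]
    linarith
  have h := integral_mono ((h1.add h2).add (h3.div_const 144))
    (integrable_psi hp1 hp2 (hX.add hY)) (fun ω => by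
      have hy := psi_nonneg hp1 (Y ω)
      have hx := psi_nonneg hp1 (X ω)
      change psi p (X ω) + dpsi p (X ω) * Y ω + φ (X ω) * psi p (Y ω) / 144 ≤ psi p (X ω + Y ω)
      rcases le_total |X ω| 1 with hle | hge
      · have := psi_strong_convex hp1 hp2 hle (Y ω)
        have : φ (X ω) * psi p (Y ω) ≤ 1 * psi p (Y ω) := by
          gcongr; simp only [hφ]; linarith
        linarith
      · have := psi_tangent_le hp1 (X ω) (Y ω)
        have h6 : φ (X ω) ≤ 0 := by
          have := one_le_psi hp1 hp2 hge
          simp only [hφ]; linarith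
        have := mul_nonpos_of_nonpos_of_nonneg h6 hy
        linarith)
  simp only [Pi.add_apply] at h
  rw [integral_add (by exact h1.add h2) (h3.div_const 144), integral_add h1 h2,
    integral_dpsi_mul hp1 hp2 hX hY hXY hY0, integral_div, h4] at h
  have h7 : 1 / 2 * ∫ ω, psi p (Y ω) ∂μ ≤ (∫ ω, φ (X ω) ∂μ) * ∫ ω, psi p (Y ω) ∂μ :=
    mul_le_mul_of_nonneg_right h5 (integral_psi_nonneg hp1 Y)
  linarith

/-- Upper modular estimate: `E ψ(∑ Yₖ) ≤ 15 ∑ E ψ(Yₖ)` for independent mean zero `Yₖ`. -/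
lemma integral_psi_sum_le (hp1 : 1 ≤ p) (hp2 : p ≤ 2) {Y : ℕ → Ω → ℝ}
    (hY : ∀ k, MemLp (Y k) (ENNReal.ofReal p) μ) (hY0 : ∀ k, ∫ ω, Y k ω ∂μ = 0)
    (hind : iIndepFun Y μ) (s : Finset ℕ) :
    ∫ ω, psi p (∑ k ∈ s, Y k ω) ∂μ ≤ 15 * ∑ k ∈ s, ∫ ω, psi p (Y k ω) ∂μ := by
  induction s using Finset.induction_on with
  | empty => simp [psi_zero]
  | insert k s hk ih =>
    have hXY : IndepFun (fun ω => ∑ j ∈ s, Y j ω) (Y k) μ := by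
      have := hind.indepFun_finsetSum_of_notMem₀ (fun i => (hY i).1.aemeasurable) hk
      simpa [Finset.sum_fn] using this
    have hS : MemLp (fun ω => ∑ j ∈ s, Y j ω) (ENNReal.ofReal p) μ :=
      memLp_finsetSum s fun j _ => hY j
    have := integral_psi_add_le hp1 hp2 hS (hY k) hXY (hY0 k)
    simp only [Finset.sum_insert hk]
    simp_rw [add_comm (Y k _)]
    linarith

/-- Lower modular estimate: if `E ψ(∑ Yₖ)` is small, all partial sums are small with
probability at least `1/2`, and strong convexity of `ψ` near `0` can be summed up. -/
lemma sum_integral_psi_le (hp1 : 1 ≤ p) (hp2 : p ≤ 2) {Y : ℕ → Ω → ℝ}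
    (hY : ∀ k, MemLp (Y k) (ENNReal.ofReal p) μ) (hY0 : ∀ k, ∫ ω, Y k ω ∂μ = 0)
    (hind : iIndepFun Y μ) (s : Finset ℕ) (hs : ∫ ω, psi p (∑ k ∈ s, Y k ω) ∂μ ≤ 1 / 5) :
    ∑ k ∈ s, ∫ ω, psi p (Y k ω) ∂μ ≤ 288 * ∫ ω, psi p (∑ k ∈ s, Y k ω) ∂μ := by
  induction s using Finset.induction_on with
  | empty => simp [psi_zero]
  | insert k s hk ih =>
    have hXY : IndepFun (fun ω => ∑ j ∈ s, Y j ω) (Y k) μ := by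
      have := hind.indepFun_finsetSum_of_notMem₀ (fun i => (hY i).1.aemeasurable) hk
      simpa [Finset.sum_fn] using this
    have hS : MemLp (fun ω => ∑ j ∈ s, Y j ω) (ENNReal.ofReal p) μ :=
      memLp_finsetSum s fun j _ => hY j
    simp only [Finset.sum_insert hk] at hs ⊢
    simp_rw [add_comm (Y k _)] at hs ⊢
    have hmono := integral_psi_le_add hp1 hp2 hS (hY k) hXY (hY0 k)
    have := integral_psi_add_ge hp1 hp2 hS (hY k) hXY (hY0 k) (hmono.trans hs)
    have := ih (hmono.trans hs)
    linarith
end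

/-! ### Growth of Orlicz functions and the sequence norm -/

lemma IsPowConvex.le_rpow_mul {r : ℝ} {M : ℝ → ℝ} (h : IsPowConvex r M) (h0 : M 0 = 0)
    {l t : ℝ} (hl0 : 0 ≤ l) (hl1 : l ≤ 1) (ht : 0 ≤ t) : M (l * t) ≤ l ^ r * M t := by
  have hr : 0 < r := by linarith [h.1]
  have hl : l ^ r ≤ 1 := Real.rpow_le_one hl0 hl1 hr.le
  have := h.2.2 (mem_Ici.2 (by positivity : 0 ≤ t ^ r)) (mem_Ici.2 le_rfl)
    (by positivity : 0 ≤ l ^ r) (by linarith : 0 ≤ 1 - l ^ r) (by ring)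
  have e : ∀ x : ℝ, 0 ≤ x → (x ^ r) ^ (1 / r) = x := fun x hx => by
    rw [one_div, Real.rpow_rpow_inv hx hr.ne']
  simp only [smul_eq_mul, mul_zero, add_zero] at this
  rw [← Real.mul_rpow hl0 ht, e (l * t) (by positivity), e t ht,
    Real.zero_rpow (one_div_ne_zero hr.ne'), h0] at this
  simpa using this

lemma IsPowConcave.rpow_mul_le {r : ℝ} {M : ℝ → ℝ} (h : IsPowConcave r M) (h0 : M 0 = 0)
    {l t : ℝ} (hl0 : 0 ≤ l) (hl1 : l ≤ 1) (ht : 0 ≤ t) : l ^ r * M t ≤ M (l * t) := by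
  have hr : 0 < r := by linarith [h.1]
  have hl : l ^ r ≤ 1 := Real.rpow_le_one hl0 hl1 hr.le
  have := h.2.2 (mem_Ici.2 (by positivity : 0 ≤ t ^ r)) (mem_Ici.2 le_rfl)
    (by positivity : 0 ≤ l ^ r) (by linarith : 0 ≤ 1 - l ^ r) (by ring)
  have e : ∀ x : ℝ, 0 ≤ x → (x ^ r) ^ (1 / r) = x := fun x hx => by
    rw [one_div, Real.rpow_rpow_inv hx hr.ne']
  simp only [smul_eq_mul, mul_zero, add_zero] at this
  rw [← Real.mul_rpow hl0 ht, e (l * t) (by positivity), e t ht,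
    Real.zero_rpow (one_div_ne_zero hr.ne'), h0] at this
  simpa using this

namespace IsOrliczFunction
variable {M : ℝ → ℝ}

lemma mono (hM : IsOrliczFunction M) {s t : ℝ} (hs : 0 ≤ s) (hst : s ≤ t) : M s ≤ M t :=
  hM.strictMonoOn.monotoneOn (mem_Ici.2 hs) (mem_Ici.2 (hs.trans hst)) hst

lemma pos (hM : IsOrliczFunction M) {s : ℝ} (hs : 0 < s) : 0 < M s := by
  have := hM.strictMonoOn (mem_Ici.2 le_rfl) (mem_Ici.2 hs.le) hs
  rwa [hM.map_zero] at this

lemma nonneg (hM : IsOrliczFunction M) {s : ℝ} (hs : 0 ≤ s) : 0 ≤ M s := by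
  rw [← hM.map_zero]; exact hM.mono le_rfl hs

lemma le_one (hM : IsOrliczFunction M) {s : ℝ} (hs : 0 ≤ s) (hs1 : s ≤ 1) : M s ≤ 1 := by
  rw [← hM.map_one]; exact hM.mono hs hs1

lemma le_mul (hM : IsOrliczFunction M) {l t : ℝ} (hl0 : 0 ≤ l) (hl1 : l ≤ 1) (ht : 0 ≤ t) :
    M (l * t) ≤ l * M t := by
  have := hM.convexOn.2 (mem_Ici.2 ht) (mem_Ici.2 le_rfl) hl0 (by linarith : 0 ≤ 1 - l) (by ring)
  simpa [hM.map_zero] using this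

lemma le_self (hM : IsOrliczFunction M) {s : ℝ} (hs : 0 ≤ s) (hs1 : s ≤ 1) : M s ≤ s := by
  have := hM.le_mul hs hs1 zero_le_one
  simpa [hM.map_one] using this

lemma two_mul_le (hM : IsOrliczFunction M) {s : ℝ} (hs : 0 ≤ s) : 2 * M s ≤ M (2 * s) := by
  have := hM.le_mul (l := 1 / 2) (by norm_num) (by norm_num) (by linarith : 0 ≤ 2 * s)
  rw [show 1 / 2 * (2 * s) = s by ring] at this
  linarith

lemma tsum_ofReal (hM : IsOrliczFunction M) (a : ℕ →₀ ℝ) {ρ : ℝ} (hρ : 0 < ρ) :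
    ∑' n, ENNReal.ofReal (M (|a n| / ρ)) = ENNReal.ofReal (∑ n ∈ a.support, M (|a n| / ρ)) := by
  rw [ENNReal.ofReal_sum_of_nonneg fun n _ => hM.nonneg (by positivity)]
  refine tsum_eq_sum fun n hn => ?_
  rw [Finsupp.notMem_support_iff.1 hn]
  simp [hM.map_zero]

lemma orliczSeqNorm_eq (hM : IsOrliczFunction M) (a : ℕ →₀ ℝ) :
    orliczSeqNorm M a = sInf {ρ : ℝ | 0 < ρ ∧ ∑ n ∈ a.support, M (|a n| / ρ) ≤ 1} := by
  unfold orliczSeqNorm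
  congr 1
  ext ρ
  simp only [mem_ofPred_eq]
  refine and_congr_right fun hρ => ?_
  rw [hM.tsum_ofReal a hρ, ENNReal.ofReal_le_one]

lemma orliczSeqNorm_le (hM : IsOrliczFunction M) (a : ℕ →₀ ℝ) {ρ : ℝ} (hρ : 0 < ρ)
    (h : ∑ n ∈ a.support, M (|a n| / ρ) ≤ 1) : orliczSeqNorm M a ≤ ρ := by
  rw [hM.orliczSeqNorm_eq]
  exact csInf_le ⟨0, fun x hx => hx.1.le⟩ ⟨hρ, h⟩

lemma le_orliczSeqNorm (hM : IsOrliczFunction M) (a : ℕ →₀ ℝ) {r : ℝ}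
    (h : ∀ ρ, 0 < ρ → ∑ n ∈ a.support, M (|a n| / ρ) ≤ 1 → r ≤ ρ) : r ≤ orliczSeqNorm M a := by
  rw [hM.orliczSeqNorm_eq]
  refine le_csInf ?_ fun ρ hρ => h ρ hρ.1 hρ.2
  have h0 : 0 ≤ ∑ n ∈ a.support, |a n| := Finset.sum_nonneg fun n _ => abs_nonneg _
  refine ⟨1 + ∑ n ∈ a.support, |a n|, by positivity, ?_⟩
  calc ∑ n ∈ a.support, M (|a n| / (1 + ∑ n ∈ a.support, |a n|))
      ≤ ∑ n ∈ a.support, |a n| / (1 + ∑ n ∈ a.support, |a n|) := by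
        refine Finset.sum_le_sum fun n hn => hM.le_self (by positivity) ?_
        rw [div_le_one (by positivity)]
        have := Finset.single_le_sum (f := fun n => |a n|) (fun n _ => abs_nonneg (a n)) hn
        linarith
    _ ≤ 1 := by
        rw [← Finset.sum_div, div_le_one (by positivity)]
        linarith

end IsOrliczFunction

/-! ### The Orlicz function generated by a random variable -/

/-- The modular `E ψ(s f)` of a random variable; it is the Orlicz function (up to equivalence) of
the span of independent copies of `f` in `L_p`. -/
noncomputable def modular (p : ℝ) (f : unitInterval → ℝ) (s : ℝ) : ℝ := ∫ u, psi p (s * f u)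

lemma modular_nonneg {p : ℝ} (hp1 : 1 ≤ p) (f : unitInterval → ℝ) (s : ℝ) : 0 ≤ modular p f s :=
  integral_psi_nonneg hp1 _

lemma modular_abs (p : ℝ) (f : unitInterval → ℝ) (s : ℝ) : modular p f |s| = modular p f s := by
  unfold modular
  congr 1; ext u
  rw [← psi_abs, abs_mul, abs_abs, ← abs_mul, psi_abs]

lemma modular_mono {p : ℝ} (hp1 : 1 ≤ p) (hp2 : p ≤ 2) {f : unitInterval → ℝ}
    (hf : MemLp f (ENNReal.ofReal p) volume) {s t : ℝ} (hs : 0 ≤ s) (hst : s ≤ t) :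
    modular p f s ≤ modular p f t := by
  refine integral_mono (integrable_psi hp1 hp2 (hf.const_mul s))
    (integrable_psi hp1 hp2 (hf.const_mul t)) fun u => psi_mono hp1 ?_
  rw [abs_mul, abs_mul, abs_of_nonneg hs, abs_of_nonneg (hs.trans hst)]
  gcongr

lemma modular_mul_le {p : ℝ} (hp1 : 1 ≤ p) (hp2 : p ≤ 2) {f : unitInterval → ℝ}
    (hf : MemLp f (ENNReal.ofReal p) volume) {l : ℝ} (hl : 1 ≤ l) (s : ℝ) :
    modular p f (l * s) ≤ 5 / 2 * l ^ 2 * modular p f s := by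
  unfold modular
  rw [← integral_const_mul]
  refine integral_mono (integrable_psi hp1 hp2 (hf.const_mul _))
    ((integrable_psi hp1 hp2 (hf.const_mul s)).const_mul _) fun u => ?_
  simpa only [mul_assoc] using psi_mul_le hp1 hp2 hl (s * f u)

section
variable {p : ℝ} {f : unitInterval → ℝ} {F : ℕ → unitInterval → ℝ}

lemma IsIndepCopies.memLp (hf : IsMeanZeroLp p f) (hF : IsIndepCopies f F) (k : ℕ) :
    MemLp (F k) (ENNReal.ofReal p) volume :=
  (hF.2 k).memLp_iff.2 hf.1

lemma IsIndepCopies.integral_psi (hF : IsIndepCopies f F) (k : ℕ) (s : ℝ) :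
    ∫ u, psi p (s * F k u) = modular p f s :=
  ((hF.2 k).comp (u := fun x => psi p (s * x))
    ((measurable_psi p).comp (measurable_const_mul s))).integral_eq

lemma IsIndepCopies.modular_sum (hp1 : 1 ≤ p) (hp2 : p ≤ 2) (hf : IsMeanZeroLp p f)
    (hF : IsIndepCopies f F) (b : ℕ → ℝ) (s : Finset ℕ) :
    ∫ u, psi p (∑ k ∈ s, b k * F k u) ≤ 15 * ∑ k ∈ s, modular p f (b k) ∧
    (∫ u, psi p (∑ k ∈ s, b k * F k u) ≤ 1 / 5 →
      ∑ k ∈ s, modular p f (b k) ≤ 288 * ∫ u, psi p (∑ k ∈ s, b k * F k u)) := by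
  have hY : ∀ k, MemLp (fun u => b k * F k u) (ENNReal.ofReal p) volume :=
    fun k => (hF.memLp hf k).const_mul _
  have hY0 : ∀ k, ∫ u, b k * F k u = 0 := fun k => by
    rw [integral_const_mul, (hF.2 k).integral_eq, hf.2, mul_zero]
  have hind : iIndepFun (fun k u => b k * F k u) volume :=
    hF.1.comp (fun k x => b k * x) fun k => measurable_const_mul _
  have hlaw : ∀ k, modular p f (b k) = ∫ u, psi p (b k * F k u) :=
    fun k => (hF.integral_psi k _).symm
  simp only [hlaw]
  exact ⟨integral_psi_sum_le hp1 hp2 hY hY0 hind s, sum_integral_psi_le hp1 hp2 hY hY0 hind s⟩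

/-- The number `Z` is the `L_p` norm of `X`. -/
lemma eLpNorm_eq_ofReal (hp1 : 1 ≤ p) {X : unitInterval → ℝ}
    (hX : MemLp X (ENNReal.ofReal p) volume) :
    ∃ Z : ℝ, 0 ≤ Z ∧ eLpNorm X (ENNReal.ofReal p) volume = ENNReal.ofReal Z ∧
      ∀ l : ℝ, 0 ≤ l → ∫ u, |l * X u| ^ p = (l * Z) ^ p := by
  have h0 : 0 ≤ ∫ u, |X u| ^ p := integral_nonneg fun u => by positivity
  refine ⟨(∫ u, |X u| ^ p) ^ p⁻¹, by positivity, ?_, fun l hl => ?_⟩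
  · rw [hX.eLpNorm_eq_integral_rpow_norm (by simp; linarith) (by simp),
      ENNReal.toReal_ofReal (by linarith)]
    rfl
  · rw [Real.mul_rpow hl (by positivity), Real.rpow_inv_rpow h0 (by linarith),
      ← integral_const_mul]
    congr 1; ext u
    rw [abs_mul, Real.mul_rpow (abs_nonneg _) (abs_nonneg _), abs_of_nonneg hl]

/-- The number `Z` is the `L_p` norm of `X`; up to an additive constant, `Z ^ p` is `E ψ(X)`. -/
lemma exists_norm_modular_bounds (hp1 : 1 ≤ p) (hp2 : p ≤ 2) {X : unitInterval → ℝ}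
    (hX : MemLp X (ENNReal.ofReal p) volume) :
    ∃ Z : ℝ, 0 ≤ Z ∧ eLpNorm X (ENNReal.ofReal p) volume = ENNReal.ofReal Z ∧
      ∀ l : ℝ, 0 ≤ l → ∫ u, psi p (l * X u) ≤ (l * Z) ^ p ∧
        (l * Z) ^ p ≤ (∫ u, psi p (l * X u)) + 1 := by
  obtain ⟨Z, hZ, he, h⟩ := eLpNorm_eq_ofReal hp1 hX
  refine ⟨Z, hZ, he, fun l hl => ?_⟩
  have h1 := integrable_psi hp1 hp2 (hX.const_mul l)
  have h2 := integrable_abs_rpow hp1 (hX.const_mul l)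
  rw [← h l hl]
  refine ⟨integral_mono h1 h2 fun u => psi_le_rpow hp1 hp2 _, ?_⟩
  calc ∫ u, |l * X u| ^ p ≤ ∫ u, (psi p (l * X u) + 1) :=
        integral_mono h2 (h1.add (integrable_const 1)) fun u => rpow_le_psi_add_one hp1 _
    _ = _ := by
      rw [integral_add h1 (integrable_const 1)]; simp

/-- If `Φ_f ~ M`, applying the two modular estimates to `∑ (a k / ρ) F k` with `ρ` close to the
norm of `a` in `l_M` compares the two norms. -/
theorem equivUnitVectorBasis_of_equivalentOn (hp1 : 1 ≤ p) (hp2 : p ≤ 2) {M : ℝ → ℝ}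
    (hM : IsOrliczFunction M) (hf : IsMeanZeroLp p f) (hF : IsIndepCopies f F)
    (h : EquivalentOn (Icc 0 1) M (modular p f)) : EquivUnitVectorBasis p M F := by
  obtain ⟨D, hD, h⟩ := h
  set c := min (1 / 5) (1 / (288 * D)) with hc
  have hc0 : 0 < c := by positivity
  have hc1 : c ≤ 1 := (min_le_left _ _).trans (by norm_num)
  refine ⟨(15 * D + 1) + 1 / c, by positivity, fun a => ?_⟩
  obtain ⟨Z, hZ, he, hpsi⟩ := exists_norm_modular_bounds hp1 hp2 (p := p)
    (X := fun u => ∑ k ∈ a.support, a k * F k u)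
    (memLp_finsetSum _ fun k _ => (hF.memLp hf k).const_mul _)
  have hsum : ∀ ρ u, ∑ k ∈ a.support, a k / ρ * F k u
      = 1 / ρ * ∑ k ∈ a.support, a k * F k u := fun ρ u => by
    rw [Finset.mul_sum]; refine Finset.sum_congr rfl fun k _ => by ring
  have hmod : ∀ ρ, 0 < ρ → ∀ k, modular p f (a k / ρ) = modular p f (|a k| / ρ) :=
    fun ρ hρ k => by rw [← modular_abs, abs_div, abs_of_pos hρ]
  have hN0 : 0 ≤ orliczSeqNorm M a := hM.le_orliczSeqNorm a fun ρ hρ _ => hρ.le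
  have hup : Z ≤ (15 * D + 1) * orliczSeqNorm M a := by
    rw [← div_le_iff₀' (by positivity)]
    refine hM.le_orliczSeqNorm a fun ρ hρ hs => ?_
    have h1 := (hF.modular_sum hp1 hp2 hf (fun k => a k / ρ) a.support).1
    simp only [hsum, hmod ρ hρ] at h1
    have h2 : ∑ k ∈ a.support, modular p f (|a k| / ρ) ≤ D := by
      calc ∑ k ∈ a.support, modular p f (|a k| / ρ)
          ≤ ∑ k ∈ a.support, D * M (|a k| / ρ) := by
            refine Finset.sum_le_sum fun k hk => (h _ ⟨by positivity, ?_⟩).2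
            by_contra hlt
            have h3 := Finset.single_le_sum (f := fun n => M (|a n| / ρ))
              (fun n _ => hM.nonneg (by positivity)) hk
            have h4 := hM.strictMonoOn (mem_Ici.2 zero_le_one)
              (mem_Ici.2 (by positivity : 0 ≤ |a k| / ρ)) (not_le.1 hlt)
            rw [hM.map_one] at h4
            linarith
        _ ≤ D := by rw [← Finset.mul_sum]; nlinarith
    have h3 := (hpsi (1 / ρ) (by positivity)).2
    have h4 : 1 / ρ * Z ≤ 15 * D + 1 := by
      by_contra hlt
      have h5 : 1 / ρ * Z ≤ (1 / ρ * Z) ^ p := by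
        have := Real.rpow_le_rpow_of_exponent_le (x := 1 / ρ * Z) (by linarith) hp1
        rwa [Real.rpow_one] at this
      linarith
    rw [div_le_iff₀' (by positivity)]
    rw [one_div_mul_eq_div, div_le_iff₀ hρ] at h4
    exact h4
  have hlow : c * orliczSeqNorm M a ≤ Z := by
    by_contra hlt
    rw [not_le, ← div_lt_iff₀' hc0] at hlt
    obtain ⟨ρ, hρ1, hρ2⟩ := exists_between hlt
    have hρ : 0 < ρ := lt_of_le_of_lt (by positivity) hρ1
    have h1 : 1 < ∑ n ∈ a.support, M (|a n| / ρ) := by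
      by_contra hle
      have := hM.orliczSeqNorm_le a hρ (not_lt.1 hle)
      linarith
    have h2 : 1 / D ≤ ∑ k ∈ a.support, modular p f (|a k| / ρ) := by
      -- the equivalence is available on `[0, 1]` only; a coordinate exceeding `ρ` is large enough
      -- on its own
      by_cases hall : ∀ k ∈ a.support, |a k| / ρ ≤ 1
      · calc 1 / D ≤ D⁻¹ * ∑ n ∈ a.support, M (|a n| / ρ) := by
              rw [one_div]; exact le_mul_of_one_le_right (by positivity) h1.le
          _ ≤ _ := by
            rw [Finset.mul_sum]
            exact Finset.sum_le_sum fun k hk => (h _ ⟨by positivity, hall k hk⟩).1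
      · push Not at hall
        obtain ⟨k, hk, hk1⟩ := hall
        have h3 := Finset.single_le_sum (f := fun n => modular p f (|a n| / ρ))
          (fun n _ => modular_nonneg hp1 _ _) hk
        have h4 := modular_mono hp1 hp2 hf.1 zero_le_one hk1.le
        have h5 := (h 1 (by simp)).1
        rw [hM.map_one, mul_one, ← one_div] at h5
        exact h5.trans (h4.trans h3)
    have h3 := (hF.modular_sum hp1 hp2 hf (fun k => a k / ρ) a.support).2
    simp only [hsum, hmod ρ hρ] at h3
    have h4 : c ≤ ∫ u, psi p (1 / ρ * ∑ k ∈ a.support, a k * F k u) := by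
      by_contra hlt'
      rw [not_le] at hlt'
      have h6 := h3 (hlt'.le.trans (min_le_left _ _))
      have h7 := hlt'.trans_le (min_le_right _ _)
      rw [← div_div, lt_div_iff₀ hD, lt_div_iff₀ (by norm_num)] at h7
      rw [div_le_iff₀ hD] at h2
      have := mul_le_mul_of_nonneg_right h6 hD.le
      linarith
    have h5 := h4.trans (hpsi (1 / ρ) (by positivity)).1
    have h6 : 1 / ρ * Z < c := by
      rw [one_div_mul_eq_div, div_lt_iff₀ hρ, ← div_lt_iff₀' hc0]; exact hρ1
    have h7 : (1 / ρ * Z) ^ p ≤ 1 / ρ * Z := by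
      have := Real.rpow_le_rpow_of_exponent_ge' (x := 1 / ρ * Z) (by positivity) (by linarith)
        zero_le_one hp1
      rwa [Real.rpow_one] at this
    linarith
  rw [he]
  refine ⟨ENNReal.ofReal_le_ofReal ?_, ENNReal.ofReal_le_ofReal ?_⟩
  · rw [inv_mul_le_iff₀ (by positivity)]
    have : orliczSeqNorm M a ≤ 1 / c * Z := by
      rw [one_div_mul_eq_div, le_div_iff₀ hc0]; linarith
    have : 0 ≤ (15 * D + 1) * Z := by positivity
    linarith
  · have : 0 ≤ 1 / c * orliczSeqNorm M a := by positivity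
    linarith

/-- Testing on `s (e₁ + ⋯ + eₙ)` with `n ≈ 1 / M s` recovers the Orlicz function from the norm
equivalence. -/
theorem equivalentOn_of_equivUnitVectorBasis (hp1 : 1 ≤ p) (hp2 : p ≤ 2) {M : ℝ → ℝ}
    (hM : IsOrliczFunction M) (hf : IsMeanZeroLp p f) (hF : IsIndepCopies f F)
    (h : EquivUnitVectorBasis p M F) : EquivalentOn (Icc 0 1) M (modular p f) := by
  obtain ⟨C, hC, h⟩ := h
  set l := 5 * (C + 1) with hl
  set L := 4 * C + 1 with hL
  refine ⟨300 * l ^ 2 + 40 * L ^ 2, by positivity, fun s hs => ?_⟩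
  rcases eq_or_lt_of_le hs.1 with rfl | hs0
  · simp [modular, hM.map_zero, psi_zero]
  have hMs := hM.pos hs0
  have hMs1 := hM.le_one hs.1 hs.2
  set n := ⌊1 / M s⌋₊ with hn
  have hn1 : 1 ≤ n := Nat.le_floor (by rw [le_div_iff₀ hMs]; simpa using hMs1)
  have hn1' : (1 : ℝ) ≤ n := by exact_mod_cast hn1
  have hnM : n * M s ≤ 1 := by
    rw [← le_div_iff₀ hMs]; exact Nat.floor_le (by positivity)
  have hnM2 : 1 < 2 * n * M s := by
    rw [← div_lt_iff₀ hMs]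
    have := Nat.lt_floor_add_one (1 / M s)
    linarith
  let a : ℕ →₀ ℝ := Finsupp.indicator (Finset.range n) fun _ _ => s
  have ha : ∀ k ∈ Finset.range n, a k = s := fun k hk => Finsupp.indicator_of_mem hk _
  have hsupp : a.support = Finset.range n := by
    ext k
    by_cases hk : k ∈ Finset.range n
    · simp [hk, ha k hk, hs0.ne']
    · simp only [hk, iff_false, Finsupp.notMem_support_iff]
      exact Finsupp.indicator_of_notMem hk _
  have hsumM : ∀ ρ, ∑ k ∈ a.support, M (|a k| / ρ) = n * M (s / ρ) := fun ρ => by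
    rw [hsupp, Finset.sum_congr rfl fun k hk => by rw [ha k hk, abs_of_pos hs0]]
    simp
  have hN1 : orliczSeqNorm M a ≤ 1 := by
    refine hM.orliczSeqNorm_le a one_pos ?_
    rw [hsumM, div_one]; exact hnM
  have hN2 : 1 / 2 ≤ orliczSeqNorm M a := by
    refine hM.le_orliczSeqNorm a fun ρ hρ hle => ?_
    by_contra hlt
    rw [hsumM] at hle
    have h1 : M (2 * s) ≤ M (s / ρ) := hM.mono (by linarith) (by
      rw [le_div_iff₀ hρ]; nlinarith)
    have := hM.two_mul_le hs.1
    have : n * (2 * M s) ≤ n * M (s / ρ) := by gcongr; linarith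
    linarith
  obtain ⟨Z, hZ, he, hpsi⟩ := exists_norm_modular_bounds hp1 hp2 (p := p)
    (X := fun u => ∑ k ∈ a.support, a k * F k u)
    (memLp_finsetSum _ fun k _ => (hF.memLp hf k).const_mul _)
  obtain ⟨hlo, hup⟩ := h a
  rw [he, ENNReal.ofReal_le_ofReal_iff hZ] at hlo
  rw [he, ENNReal.ofReal_le_ofReal_iff (by
    have : 0 ≤ orliczSeqNorm M a := by linarith
    positivity)] at hup
  have hZC : Z ≤ C := hup.trans (mul_le_of_le_one_right hC.le hN1)
  have hCZ : 1 ≤ 2 * C * Z := by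
    rw [inv_mul_le_iff₀ hC] at hlo; linarith
  have hsum : ∀ r u, ∑ k ∈ Finset.range n, r * s * F k u
      = r * ∑ k ∈ a.support, a k * F k u := fun r u => by
    rw [hsupp, Finset.mul_sum]
    refine Finset.sum_congr rfl fun k hk => by rw [ha k hk]; ring
  have hl1 : 1 ≤ l := by rw [hl]; linarith
  have hL1 : 1 ≤ L := by rw [hL]; linarith
  have hmod0 := modular_nonneg hp1 f s
  constructor
  · have h1 := (hF.modular_sum hp1 hp2 hf (fun _ => L * s) (Finset.range n)).1
    simp only [hsum, Finset.sum_const, Finset.card_range, nsmul_eq_mul] at h1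
    have h2 := (hpsi L (by linarith)).2
    have h3 : 2 ≤ (L * Z) ^ p := by
      have h4 : 2 ≤ L * Z := by rw [hL]; nlinarith
      calc (2 : ℝ) = 2 ^ (1 : ℝ) := by simp
        _ ≤ 2 ^ p := Real.rpow_le_rpow_of_exponent_le (by norm_num) hp1
        _ ≤ (L * Z) ^ p := by gcongr
    have h5 := modular_mul_le hp1 hp2 hf.1 hL1 s
    have h6 : 1 ≤ 40 * L ^ 2 * (n * modular p f s) := by
      have : n * modular p f (L * s) ≤ n * (5 / 2 * L ^ 2 * modular p f s) := by gcongr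
      have : 0 ≤ L ^ 2 * (n * modular p f s) := by positivity
      linarith
    rw [inv_mul_le_iff₀ (by positivity)]
    have h7 : M s ≤ 40 * L ^ 2 * modular p f s := by
      have h8 := mul_le_mul_of_nonneg_left h6 hMs.le
      have h9 := mul_le_mul_of_nonneg_left hnM
        (by positivity : 0 ≤ 40 * L ^ 2 * modular p f s)
      nlinarith
    have : 0 ≤ 300 * l ^ 2 * modular p f s := by positivity
    linarith
  · have h1 := (hF.modular_sum hp1 hp2 hf (fun _ => l⁻¹ * s) (Finset.range n)).2
    simp only [hsum, Finset.sum_const, Finset.card_range, nsmul_eq_mul] at h1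
    have h2 := (hpsi l⁻¹ (by positivity)).1
    have h3 : (l⁻¹ * Z) ^ p ≤ 1 / 5 := by
      have h4 : l⁻¹ * Z ≤ 1 / 5 := by
        rw [inv_mul_le_iff₀ (by positivity), hl]; linarith
      calc (l⁻¹ * Z) ^ p ≤ (1 / 5) ^ p := by gcongr
        _ ≤ (1 / 5) ^ (1 : ℝ) :=
          Real.rpow_le_rpow_of_exponent_ge (by norm_num) (by norm_num) hp1
        _ = 1 / 5 := by simp
    have h4 := h1 (h2.trans h3)
    have h5 := modular_mul_le hp1 hp2 hf.1 hl1 (l⁻¹ * s)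
    rw [mul_inv_cancel_left₀ (by positivity)] at h5
    have h6 : n * modular p f s ≤ 150 * l ^ 2 := by
      have h7 : n * modular p f s ≤ 5 / 2 * l ^ 2 * (n * modular p f (l⁻¹ * s)) := by
        calc n * modular p f s ≤ n * (5 / 2 * l ^ 2 * modular p f (l⁻¹ * s)) := by gcongr
          _ = _ := by ring
      have h8 : n * modular p f (l⁻¹ * s) ≤ 288 / 5 := by linarith
      have : 5 / 2 * l ^ 2 * (n * modular p f (l⁻¹ * s)) ≤ 5 / 2 * l ^ 2 * (288 / 5) := by gcongr
      nlinarith [sq_nonneg l]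
    have h7 : modular p f s ≤ 300 * l ^ 2 * M s := by
      have h8 := mul_le_mul_of_nonneg_right h6 hMs.le
      have h9 := mul_le_mul_of_nonneg_right hnM2.le hmod0
      nlinarith
    have : 0 ≤ 40 * L ^ 2 * M s := by positivity
    linarith
end

/-! ### Realizing symmetric laws on the unit interval -/

lemma memLp_of_lintegral_lt_top {p : ℝ} (hp1 : 1 ≤ p) {f : unitInterval → ℝ} (hf : AEMeasurable f)
    (h : ∫⁻ u, ENNReal.ofReal (|f u| ^ p) < ⊤) : MemLp f (ENNReal.ofReal p) volume := by
  refine ⟨hf.aestronglyMeasurable, ?_⟩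
  rw [eLpNorm_lt_top_iff_lintegral_rpow_enorm_lt_top (by simp; linarith) (by simp),
    ENNReal.toReal_ofReal (by linarith)]
  refine lt_of_eq_of_lt (lintegral_congr fun u => ?_) h
  rw [Real.enorm_eq_ofReal_abs, ENNReal.ofReal_rpow_of_nonneg (abs_nonneg _) (by linarith)]

/-- Every probability law on `ℝ` with a finite `p`-th moment is, after symmetrization, the law of
a mean zero `f ∈ L_p[0,1]` of which a sequence of independent copies lives on `[0,1]`. -/
theorem exists_indepCopies_of_law {p : ℝ} (hp1 : 1 ≤ p) (μ : Measure ℝ) [IsProbabilityMeasure μ]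
    (hμ : ∫⁻ x, ENNReal.ofReal (|x| ^ p) ∂μ < ⊤) :
    ∃ (f : unitInterval → ℝ) (F : ℕ → unitInterval → ℝ), Measurable f ∧ IsMeanZeroLp p f ∧
      IsIndepCopies f F ∧
      ∀ g : ℝ → ENNReal, Measurable g → ∫⁻ u, g |f u| = ∫⁻ x, g |x| ∂μ := by
  let ν : Measure ℝ := (2⁻¹ : ENNReal) • (μ + μ.map Neg.neg)
  have hν : ν = (2⁻¹ : ENNReal) • (μ + μ.map Neg.neg) := rfl
  have hneg : Measurable (Neg.neg : ℝ → ℝ) := measurable_neg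
  have : IsProbabilityMeasure (μ.map Neg.neg) := Measure.isProbabilityMeasure_map hneg.aemeasurable
  have : IsProbabilityMeasure ν := ⟨by
    rw [hν, Measure.smul_apply, Measure.add_apply, measure_univ, measure_univ, smul_eq_mul,
      one_add_one_eq_two]
    exact ENNReal.inv_mul_cancel (by simp) (by simp)⟩
  have hνneg : ν.map Neg.neg = ν := by
    rw [hν, Measure.map_smul, Measure.map_add _ _ hneg, Measure.map_map hneg hneg, add_comm]
    simp
  have hνint : ∀ g : ℝ → ENNReal, Measurable g → ∫⁻ x, g |x| ∂ν = ∫⁻ x, g |x| ∂μ := by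
    intro g hg
    have hg' : Measurable fun x => g |x| := hg.comp measurable_abs
    rw [hν, lintegral_smul_measure, lintegral_add_measure, lintegral_map hg' hneg]
    simp only [abs_neg]
    rw [← two_mul, smul_eq_mul, ← mul_assoc, ENNReal.inv_mul_cancel (by simp) (by simp), one_mul]
  obtain ⟨Y, hYm, hYmap⟩ := Measure.exists_measurable_map_eq (Measure.infinitePi fun _ : ℕ => ν)
  have hFm : ∀ k, Measurable fun u => Y u k := fun k => (measurable_pi_apply k).comp hYm
  have hlaw : ∀ k, (volume : Measure unitInterval).map (fun u => Y u k) = ν := by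
    intro k
    rw [show (fun u => Y u k) = (fun y : ℕ → ℝ => y k) ∘ Y from rfl,
      ← Measure.map_map (measurable_pi_apply k) hYm, hYmap]
    exact Measure.infinitePi_map_eval _ k
  have hf : ∀ g : ℝ → ENNReal, Measurable g → ∫⁻ u, g |Y u 0| = ∫⁻ x, g |x| ∂μ := by
    intro g hg
    have hg' : Measurable fun x => g |x| := hg.comp measurable_abs
    rw [← hνint g hg, ← hlaw 0, lintegral_map hg' (hFm 0)]
  refine ⟨fun u => Y u 0, fun k u => Y u k, hFm 0, ⟨?_, ?_⟩, ⟨?_, ?_⟩, hf⟩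
  · refine memLp_of_lintegral_lt_top hp1 (hFm 0).aemeasurable ?_
    rw [hf (fun x => ENNReal.ofReal (x ^ p)) (by fun_prop)]
    exact hμ
  · have h1 : ∫ u, Y u 0 = ∫ x, x ∂ν := by
      rw [← hlaw 0, integral_map (hFm 0).aemeasurable (by fun_prop)]
    have h2 : ∫ x, x ∂ν = -∫ x, x ∂ν := by
      conv_lhs => rw [← hνneg]
      rw [integral_map hneg.aemeasurable (by fun_prop), integral_neg]
    rw [h1]; linarith
  · rw [iIndepFun_iff_map_fun_eq_infinitePi_map hFm]
    simp only [hlaw]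
    exact hYmap
  · intro k
    exact ⟨(hFm k).aemeasurable, (hFm 0).aemeasurable, by rw [hlaw, hlaw]⟩

/-! ### The gap condition and strict intermediacy -/

lemma equivalentOn_of_le {S : Set ℝ} {f g : ℝ → ℝ} {k₁ k₂ : ℝ} (hk₁ : 0 < k₁) (hk₂ : 0 < k₂)
    (hf : ∀ t ∈ S, 0 ≤ f t) (h₁ : ∀ t ∈ S, k₁ * f t ≤ g t) (h₂ : ∀ t ∈ S, g t ≤ k₂ * f t) :
    EquivalentOn S f g := by
  refine ⟨k₂ + 1 / k₁, by positivity, fun t ht => ⟨?_, ?_⟩⟩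
  · refine le_trans ?_ (h₁ t ht)
    have := hf t ht
    gcongr
    rw [inv_le_comm₀ (by positivity) hk₁, ← one_div]
    linarith
  · refine (h₂ t ht).trans ?_
    have := hf t ht
    gcongr
    have : 0 < 1 / k₁ := by positivity
    linarith

/-- With `R s = M s / s ^ p` and `T s = M s / s ^ 2`, this says that for some step `A > 1` one has
`R s ≤ η * R (A * s)` and `T (A * s) ≤ η * T s` whenever `0 < s ≤ 1 / A`. For `η < 1` it expresses
that the growth exponents of `M` at `0` lie strictly between `p` and `2`. -/
def PowGap (p : ℝ) (M : ℝ → ℝ) (η : ℝ) : Prop :=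
  ∃ A : ℝ, 1 < A ∧ ∀ s, 0 < s → A * s ≤ 1 →
    A ^ p * M s ≤ η * M (A * s) ∧ M (A * s) ≤ η * A ^ 2 * M s

lemma IsStrictlyBetween.powGap {p : ℝ} {M : ℝ → ℝ} (hM : IsOrliczFunction M)
    (h : IsStrictlyBetween p M) {η : ℝ} (hη : 0 < η) : PowGap p M η := by
  obtain ⟨ε, hε, N, hN, ⟨C, hC, hMN⟩, hconv, hconc⟩ := h
  obtain ⟨A, hA1, hA⟩ := ((Filter.eventually_gt_atTop 1).and
    ((tendsto_rpow_atTop hε).eventually_ge_atTop (C ^ 2 / η))).exists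
  have hA0 : 0 < A := by linarith
  rw [div_le_iff₀ hη] at hA
  refine ⟨A, hA1, fun s hs hAs => ?_⟩
  have hAs0 : 0 < A * s := by positivity
  have hs1 : s ≤ 1 := by nlinarith
  have h1 : M s ≤ C * N s := (inv_mul_le_iff₀ hC).1 (hMN s ⟨hs.le, hs1⟩).1
  have h2 : M (A * s) ≤ C * N (A * s) := (inv_mul_le_iff₀ hC).1 (hMN _ ⟨hAs0.le, hAs⟩).1
  have h3 := (hMN s ⟨hs.le, hs1⟩).2
  have h4 := (hMN _ ⟨hAs0.le, hAs⟩).2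
  have hMs := hM.pos hs
  have hMAs := hM.pos hAs0
  have hinv : A⁻¹ * (A * s) = s := by rw [inv_mul_cancel_left₀ hA0.ne']
  constructor
  · have h5 := hconv.le_rpow_mul hN.map_zero (l := A⁻¹) (t := A * s) (by positivity)
      (inv_le_one_of_one_le₀ hA1.le) hAs0.le
    rw [hinv, Real.inv_rpow hA0.le, ← div_eq_inv_mul, le_div_iff₀ (by positivity),
      Real.rpow_add hA0] at h5
    -- `A ^ (p + ε) M s ≤ C ^ 2 M (A s)`, and `A ^ ε` absorbs the constant
    have h6 : A ^ ε * (A ^ p * M s) ≤ A ^ ε * (η * M (A * s)) := by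
      calc A ^ ε * (A ^ p * M s) ≤ A ^ ε * (A ^ p * (C * N s)) := by gcongr
        _ = C * (N s * (A ^ p * A ^ ε)) := by ring
        _ ≤ C * (C * M (A * s)) := mul_le_mul_of_nonneg_left (h5.trans h4) hC.le
        _ = C ^ 2 * M (A * s) := by ring
        _ ≤ A ^ ε * η * M (A * s) := by gcongr
        _ = _ := by ring
    exact le_of_mul_le_mul_left h6 (by positivity)
  · have h5 := hconc.rpow_mul_le hN.map_zero (l := A⁻¹) (t := A * s) (by positivity)
      (inv_le_one_of_one_le₀ hA1.le) hAs0.le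
    rw [hinv, Real.inv_rpow hA0.le, inv_mul_le_iff₀ (by positivity)] at h5
    have hA2 : A ^ (2 - ε) * A ^ ε = A ^ 2 := by
      rw [← Real.rpow_add hA0, ← Real.rpow_natCast]; congr 1; push_cast; ring
    have h6 : A ^ ε * M (A * s) ≤ A ^ ε * (η * A ^ 2 * M s) := by
      calc A ^ ε * M (A * s) ≤ A ^ ε * (C * (A ^ (2 - ε) * N s)) := by
            gcongr; exact h2.trans (by gcongr)
        _ ≤ A ^ ε * (C * (A ^ (2 - ε) * (C * M s))) := by gcongr
        _ = C ^ 2 * ((A ^ (2 - ε) * A ^ ε) * M s) := by ring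
        _ ≤ (A ^ ε * η) * ((A ^ (2 - ε) * A ^ ε) * M s) := by gcongr
        _ = _ := by rw [hA2]; ring
    exact le_of_mul_le_mul_left h6 (by positivity)

/-- A series dominated by `v` (geometrically increasing) and by `u` (geometrically decreasing) is
dominated by the two terms at which one switches from one bound to the other. -/
lemma summable_and_tsum_le_of_geometric {t u v : ℕ → ℝ} {q : ℝ} (hq0 : 0 ≤ q) (hq1 : q < 1)
    (ht : ∀ j, 0 ≤ t j) (htu : ∀ j, t j ≤ u j) (htv : ∀ j, t j ≤ v j)
    (hu : ∀ j, u (j + 1) ≤ q * u j) (hv : ∀ j, v j ≤ q * v (j + 1)) :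
    Summable t ∧ ∀ i, ∑' j, t j ≤ (v i + u (i + 1)) / (1 - q) := by
  have h1q : 0 < 1 - q := by linarith
  have hugeo : ∀ i j, u (j + i) ≤ u i * q ^ j := by
    intro i j
    induction j with
    | zero => simp
    | succ j ih =>
      have := hu (j + i)
      rw [show j + 1 + i = j + i + 1 by ring, pow_succ]
      nlinarith
  have hgeo : ∀ i, Summable fun j => u i * q ^ j := fun i =>
    (summable_geometric_of_lt_one hq0 hq1).mul_left _
  have hsum : Summable t := by
    refine (hgeo 0).of_nonneg_of_le ht fun j => (htu j).trans ?_
    simpa using hugeo 0 j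
  refine ⟨hsum, fun i => ?_⟩
  have hhead : ∀ i, ∑ j ∈ Finset.range (i + 1), v j ≤ v i / (1 - q) := by
    intro i
    induction i with
    | zero =>
      have : 0 ≤ v 0 := (ht 0).trans (htv 0)
      rw [le_div_iff₀ h1q]
      simp
      nlinarith
    | succ i ih =>
      rw [Finset.sum_range_succ]
      rw [le_div_iff₀ h1q] at ih ⊢
      have := hv i
      nlinarith
  have htail : ∑' j, t (j + (i + 1)) ≤ u (i + 1) / (1 - q) := by
    calc ∑' j, t (j + (i + 1)) ≤ ∑' j, u (i + 1) * q ^ j :=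
          ((summable_nat_add_iff (i + 1)).2 hsum).tsum_le_tsum
            (fun j => (htu _).trans (hugeo _ _)) (hgeo _)
      _ = u (i + 1) / (1 - q) := by
          rw [tsum_mul_left, tsum_geometric_of_lt_one hq0 hq1, div_eq_mul_inv]
  rw [← hsum.sum_add_tsum_nat_add (i + 1), add_div]
  exact add_le_add ((Finset.sum_le_sum fun j _ => htv j).trans (hhead i)) htail

lemma convexOn_tsum {S : Set ℝ} (hS : Convex ℝ S) {f : ℕ → ℝ → ℝ} (hf : ∀ j, ConvexOn ℝ S (f j))
    (hs : ∀ x ∈ S, Summable fun j => f j x) : ConvexOn ℝ S fun x => ∑' j, f j x := by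
  refine ⟨hS, fun x hx y hy a b ha hb hab => ?_⟩
  simp only [smul_eq_mul]
  rw [← tsum_mul_left, ← tsum_mul_left, ← ((hs x hx).mul_left a).tsum_add ((hs y hy).mul_left b)]
  exact (hs _ (hS hx hy ha hb hab)).tsum_le_tsum (fun j => (hf j).2 hx hy ha hb hab)
    (((hs x hx).mul_left a).add ((hs y hy).mul_left b))

lemma concaveOn_tsum {S : Set ℝ} (hS : Convex ℝ S) {f : ℕ → ℝ → ℝ}
    (hf : ∀ j, ConcaveOn ℝ S (f j)) (hs : ∀ x ∈ S, Summable fun j => f j x) :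
    ConcaveOn ℝ S fun x => ∑' j, f j x := by
  have := convexOn_tsum hS (fun j => (hf j).neg) fun x hx => (hs x hx).neg
  refine neg_convexOn_iff.1 (this.congr fun x _ => ?_)
  simp [tsum_neg]

/-- Minkowski's inequality for the `ℓ_r` norm of `(1, y)`. -/
lemma convexOn_one_add_rpow {r : ℝ} (hr : 1 ≤ r) :
    ConvexOn ℝ (Ici 0) fun y : ℝ => (1 + y ^ r) ^ (1 / r) := by
  refine ⟨convex_Ici 0, fun x hx y hy a b ha hb hab => ?_⟩
  have hx : 0 ≤ x := hx
  have hy : 0 ≤ y := hy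
  have h := Real.Lp_add_le_of_nonneg (s := Finset.univ) (f := ![a, a * x]) (g := ![b, b * y]) hr
    (by intro i _; fin_cases i <;> simp <;> positivity)
    (by intro i _; fin_cases i <;> simp <;> positivity)
  simp only [Fin.sum_univ_two, Matrix.cons_val_zero, Matrix.cons_val_one, hab, Real.one_rpow] at h
  have e : ∀ c z : ℝ, 0 ≤ c → 0 ≤ z → (c ^ r + (c * z) ^ r) ^ (1 / r)
      = c * (1 + z ^ r) ^ (1 / r) := fun c z hc hz => by
    rw [Real.mul_rpow hc hz, show c ^ r + c ^ r * z ^ r = c ^ r * (1 + z ^ r) by ring,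
      Real.mul_rpow (by positivity) (by positivity), one_div, Real.rpow_rpow_inv hc (by linarith)]
  rw [e a x ha hx, e b y hb hy] at h
  simpa using h

lemma convexOn_shiftPow_comp {a b c : ℝ} (ha : 0 < a) (hab : a ≤ b) (hc : 0 ≤ c) :
    ConvexOn ℝ (Ici 0) fun t : ℝ => shiftPow (a / b) ((t ^ (1 / a) * c) ^ b) := by
  have hb : 0 < b := by linarith
  have h := (convexOn_one_add_rpow (r := b / a) ((one_le_div ha).2 hab)).comp_linearMap
    (LinearMap.mulRight ℝ (c ^ a))
  have h2 := (h.subset (s := (Ici 0 : Set ℝ)) (fun t ht => by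
    have : 0 ≤ t := ht
    simp only [mem_preimage, LinearMap.mulRight_apply, mem_Ici]; positivity)
    (convex_Ici 0)).add_const (-1)
  refine h2.congr fun t ht => ?_
  have ht : 0 ≤ t := ht
  simp only [Function.comp_apply, LinearMap.mulRight_apply, shiftPow, Pi.add_apply]
  have : (t * c ^ a) ^ (b / a) = (t ^ (1 / a) * c) ^ b := by
    rw [Real.mul_rpow ht (by positivity), Real.mul_rpow (by positivity) hc, ← Real.rpow_mul hc,
      ← Real.rpow_mul ht]
    congr 2 <;> field_simp
  rw [this, one_div_div]
  ring

lemma concaveOn_shiftPow_comp {a b c : ℝ} (ha : 0 < a) (hab : a ≤ b) (hc : 0 ≤ c) :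
    ConcaveOn ℝ (Ici 0) fun t : ℝ => shiftPow (a / b) ((t ^ (1 / b) * c) ^ b) := by
  have hb : 0 < b := by linarith
  have hcc := Real.concaveOn_rpow (p := a / b) (by positivity) ((div_le_one hb).2 hab)
  have h := hcc.comp_affineMap (AffineMap.lineMap (1 : ℝ) (1 + c ^ b))
  have h2 := (h.subset (s := (Ici 0 : Set ℝ)) (fun t ht => by
    have : 0 ≤ t := ht
    simp only [mem_preimage, AffineMap.lineMap_apply, mem_Ici, vsub_eq_sub, vadd_eq_add,
      smul_eq_mul]
    ring_nf; positivity) (convex_Ici 0)).add_const (-1)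
  refine h2.congr fun t ht => ?_
  have ht : 0 ≤ t := ht
  simp only [Function.comp_apply, AffineMap.lineMap_apply, shiftPow, Pi.add_apply, vsub_eq_sub,
    vadd_eq_add, smul_eq_mul]
  rw [Real.mul_rpow (by positivity) hc, one_div, Real.rpow_inv_rpow ht hb.ne']
  ring_nf

/-- Surjectivity of `N` comes from `N s ≤ s` on `[0, 1]`, `s ≤ N s` on `[1, ∞)` and continuity. -/
lemma isOrliczFunction_of_isPowConvex {r : ℝ} {N : ℝ → ℝ} (h : IsPowConvex r N) (h0 : N 0 = 0)
    (h1 : N 1 = 1) (hpos : ∀ s, 0 < s → 0 < N s) : IsOrliczFunction N := by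
  have hr : 0 < r := by linarith [h.1]
  have hnn : ∀ s, 0 ≤ s → 0 ≤ N s := fun s hs => by
    rcases hs.eq_or_lt with rfl | hs
    · exact h0.ge
    · exact (hpos s hs).le
  have hstrict : StrictMonoOn N (Ici 0) := by
    intro x hx y hy hxy
    have hx : 0 ≤ x := hx
    have hy : 0 < y := hx.trans_lt hxy
    have h2 := h.le_rpow_mul h0 (l := x / y) (t := y) (by positivity)
      ((div_le_one hy).2 hxy.le) hy.le
    rw [div_mul_cancel₀ _ hy.ne'] at h2
    have h3 : (x / y) ^ r < 1 := Real.rpow_lt_one (by positivity) ((div_lt_one hy).2 hxy) hr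
    have := hpos y hy
    nlinarith
  have hinv : ∀ x : ℝ, 0 ≤ x → (x ^ r) ^ (1 / r) = x := fun x hx => by
    rw [one_div, Real.rpow_rpow_inv hx hr.ne']
  have hconv : ConvexOn ℝ (Ici 0) N := by
    refine ⟨convex_Ici 0, fun x hx y hy a b ha hb hab => ?_⟩
    have hx' : 0 ≤ x := hx
    have hy' : 0 ≤ y := hy
    have h2 := (convexOn_rpow h.1).2 hx hy ha hb hab
    have h3 := h.2.2 (mem_Ici.2 (by positivity : 0 ≤ x ^ r)) (mem_Ici.2 (by positivity : 0 ≤ y ^ r))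
      ha hb hab
    simp only [smul_eq_mul, hinv x hx', hinv y hy'] at h2 h3 ⊢
    refine le_trans ?_ h3
    refine hstrict.monotoneOn (mem_Ici.2 (by positivity)) (mem_Ici.2 (by positivity)) ?_
    calc a * x + b * y = ((a * x + b * y) ^ r) ^ (1 / r) := (hinv _ (by positivity)).symm
      _ ≤ (a * x ^ r + b * y ^ r) ^ (1 / r) := by gcongr
  have hle : ∀ l t : ℝ, 0 ≤ l → l ≤ 1 → 0 ≤ t → N (l * t) ≤ l * N t := fun l t hl hl1 ht => by
    have := hconv.2 (mem_Ici.2 ht) (mem_Ici.2 le_rfl) hl (by linarith : 0 ≤ 1 - l) (by ring)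
    simpa [h0] using this
  refine ⟨hconv, hstrict, h0, h1, fun s hs => hnn s hs, hstrict.injOn, ?_⟩
  intro y hy
  rcases (show (0 : ℝ) ≤ y from hy).eq_or_lt with rfl | hy
  · exact ⟨0, mem_Ici.2 le_rfl, h0⟩
  have hcont : ContinuousOn N (Ioi 0) := by
    have := hconv.continuousOn_interior
    rwa [interior_Ici] at this
  have hlo : N (min y 1) ≤ y := by
    have := hle (min y 1) 1 (by positivity) (min_le_right _ _) zero_le_one
    rw [h1, mul_one] at this
    exact this.trans (min_le_left _ _)
  have hhi : y ≤ N (max y 1) := by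
    have hm : 1 ≤ max y 1 := le_max_right _ _
    have hm0 : 0 < max y 1 := by linarith
    have := hle (max y 1)⁻¹ (max y 1) (by positivity) (inv_le_one_of_one_le₀ hm) hm0.le
    rw [inv_mul_cancel₀ hm0.ne', h1, ← div_eq_inv_mul, le_div_iff₀ hm0, one_mul] at this
    exact (le_max_left _ _).trans this
  have hmin : 0 < min y 1 := by positivity
  obtain ⟨s, hs, hsy⟩ := intermediate_value_Icc (min_le_max : min y 1 ≤ max y 1)
    (hcont.mono fun x hx => lt_of_lt_of_le hmin hx.1) ⟨hlo, hhi⟩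
  exact ⟨s, mem_Ici.2 (hmin.le.trans hs.1), hsy⟩

section
variable {p : ℝ} {M : ℝ → ℝ}

lemma mul_le_sq_mul (hM : IsOrliczFunction M) (hconc : IsPowConcave 2 M) {A s : ℝ} (hA : 1 ≤ A)
    (hs : 0 ≤ s) : M (A * s) ≤ A ^ 2 * M s := by
  have hA0 : 0 < A := by linarith
  have := hconc.rpow_mul_le hM.map_zero (l := A⁻¹) (t := A * s) (by positivity)
    (inv_le_one_of_one_le₀ hA) (by positivity)
  rw [inv_mul_cancel_left₀ hA0.ne', Real.inv_rpow hA0.le, inv_mul_le_iff₀ (by positivity)] at this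
  simpa using this

lemma rpow_mul_le_of_powConvex (hM : IsOrliczFunction M) (hconv : IsPowConvex p M) {A s : ℝ}
    (hA : 1 ≤ A) (hs : 0 ≤ s) : A ^ p * M s ≤ M (A * s) := by
  have hA0 : 0 < A := by linarith
  have := hconv.le_rpow_mul hM.map_zero (l := A⁻¹) (t := A * s) (by positivity)
    (inv_le_one_of_one_le₀ hA) (by positivity)
  rwa [inv_mul_cancel_left₀ hA0.ne', Real.inv_rpow hA0.le, le_inv_mul_iff₀ (by positivity)] at this

/-- The function `N s = ∑ M (A ^ (-j)) ((1 + (A ^ j s) ^ b) ^ (a / b) - 1)` with `a = p + ε` and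
`b = 2 - ε` is `a`-convex and `b`-concave because every summand is, and the gap condition makes it
equivalent to `M`. -/
theorem PowGap.isStrictlyBetween (hp1 : 1 ≤ p) (hM : IsOrliczFunction M)
    (hconc : IsPowConcave 2 M) (h : PowGap p M (1 / 2)) : IsStrictlyBetween p M := by
  obtain ⟨A, hA1, hgap⟩ := h
  have hA0 : 0 < A := by linarith
  have hlogA : 0 < Real.log A := Real.log_pos hA1
  -- `ε` is such that `A ^ ε = 3 / 2`: shifting the exponents by `ε` turns the ratio `1 / 2` of the
  -- gap condition into `3 / 4`
  set ε := Real.log (3 / 2) / Real.log A with hε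
  have hε0 : 0 < ε := div_pos (Real.log_pos (by norm_num)) hlogA
  have hAε : A ^ ε = 3 / 2 := by
    rw [Real.rpow_def_of_pos hA0, hε, mul_div_cancel₀ _ hlogA.ne', Real.exp_log (by norm_num)]
  have hpε : p + 2 * ε ≤ 2 := by
    obtain ⟨h1, h2⟩ := hgap A⁻¹ (by positivity) (mul_inv_cancel₀ hA0.ne').le
    have hMA := hM.pos (inv_pos.2 hA0)
    have h3 : A ^ p * 4 ≤ A ^ 2 := by nlinarith
    rw [← Real.rpow_le_rpow_left_iff hA1, Real.rpow_add hA0, mul_comm 2 ε, Real.rpow_mul hA0.le,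
      hAε, Real.rpow_two, Real.rpow_two]
    have : 0 ≤ A ^ p := by positivity
    linarith
  set a := p + ε with ha
  set b := 2 - ε with hb
  have hab : a ≤ b := by rw [ha, hb]; linarith
  have ha0 : 0 < a := by rw [ha]; linarith
  have hb0 : 0 < b := by linarith
  have hAa : A ^ a = A ^ p * (3 / 2) := by rw [ha, Real.rpow_add hA0, hAε]
  have hAb : A ^ b * (3 / 2) = A ^ 2 := by
    rw [← hAε, ← Real.rpow_add hA0, hb, sub_add_cancel, Real.rpow_two]
  have hθ : 1 / 2 ≤ a / b := by
    rw [le_div_iff₀ hb0]; rw [ha, hb]; linarith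
  have hθ1 : a / b ≤ 1 := (div_le_one hb0).2 hab
  let c : ℕ → ℝ := fun j => M (A⁻¹ ^ j)
  have hc0 : ∀ j, 0 < c j := fun j => hM.pos (by positivity)
  have hcA : ∀ j, A * A⁻¹ ^ (j + 1) = A⁻¹ ^ j := fun j => by
    rw [pow_succ']; field_simp
  have hcgap : ∀ j, A ^ p * c (j + 1) ≤ 1 / 2 * c j ∧ c j ≤ 1 / 2 * A ^ 2 * c (j + 1) := fun j => by
    have := hgap (A⁻¹ ^ (j + 1)) (by positivity) (by
      rw [hcA]; exact pow_le_one₀ (by positivity) (inv_le_one_of_one_le₀ hA1.le))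
    rwa [hcA] at this
  let t : ℝ → ℕ → ℝ := fun s j => c j * shiftPow (a / b) ((s * A ^ j) ^ b)
  let N₀ : ℝ → ℝ := fun s => ∑' j, t s j
  have htn : ∀ s, 0 ≤ s → ∀ j, 0 ≤ t s j := fun s hs j =>
    mul_nonneg (hc0 j).le (shiftPow_nonneg (by positivity) (by positivity))
  have hmain : ∀ s, 0 ≤ s → Summable (t s) ∧
      ∀ i, N₀ s ≤ (c i * (s * A ^ i) ^ b + c (i + 1) * (s * A ^ (i + 1)) ^ a) / (1 - 3 / 4) := by
    intro s hs
    refine summable_and_tsum_le_of_geometric (by norm_num) (by norm_num) (htn s hs)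
      (u := fun j => c j * (s * A ^ j) ^ a) (v := fun j => c j * (s * A ^ j) ^ b)
      (fun j => ?_) (fun j => ?_) (fun j => ?_) fun j => ?_
    · refine mul_le_mul_of_nonneg_left ?_ (hc0 j).le
      refine (shiftPow_le_rpow (by positivity) hθ1 (by positivity)).trans (le_of_eq ?_)
      rw [← Real.rpow_mul (by positivity), mul_div_cancel₀ _ hb0.ne']
    · exact mul_le_mul_of_nonneg_left (shiftPow_le_self (by positivity) hθ1 (by positivity))
        (hc0 j).le
    · have h1 : (s * A ^ (j + 1)) ^ a = A ^ p * (3 / 2) * (s * A ^ j) ^ a := by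
        rw [← hAa, ← Real.mul_rpow hA0.le (by positivity)]; congr 1; ring
      have h2 := mul_le_mul_of_nonneg_right (hcgap j).1 (by positivity : 0 ≤ (s * A ^ j) ^ a)
      simp only [h1]
      linarith
    · have h1 : (s * A ^ (j + 1)) ^ b = A ^ b * (s * A ^ j) ^ b := by
        rw [← Real.mul_rpow hA0.le (by positivity)]; congr 1; ring
      have h2 := mul_le_mul_of_nonneg_right (hcgap j).2 (by positivity : 0 ≤ (s * A ^ j) ^ b)
      rw [← hAb] at h2
      simp only [h1]
      linarith
  have hup : ∀ s ∈ Icc (0 : ℝ) 1, 0 < s → N₀ s ≤ 8 * A ^ 2 * M s ∧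
      M s ≤ 5 / 2 * A ^ 2 * N₀ s := by
    intro s hs hs0
    obtain ⟨i, hi1, hi2⟩ := exists_nat_pow_near_of_lt_one hs0 hs.2 (inv_pos.2 hA0)
      (inv_lt_one_of_one_lt₀ hA1)
    have e1 : A⁻¹ ^ i * A ^ i = 1 := by rw [← mul_pow, inv_mul_cancel₀ hA0.ne', one_pow]
    have e2 : A⁻¹ ^ (i + 1) * A ^ (i + 1) = 1 := by
      rw [← mul_pow, inv_mul_cancel₀ hA0.ne', one_pow]
    have hcs : c (i + 1) ≤ M s := hM.mono (by positivity) hi1.le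
    have hcAs : c i ≤ A ^ 2 * M s := by
      refine le_trans ?_ (mul_le_sq_mul hM hconc hA1.le hs0.le)
      refine hM.mono (by positivity) ?_
      rw [← hcA]; gcongr
    have hMs := hM.pos hs0
    constructor
    · refine ((hmain s hs.1).2 i).trans ?_
      have h1 : (s * A ^ i) ^ b ≤ 1 := by
        refine Real.rpow_le_one (by positivity) ?_ hb0.le
        rw [← e1]; gcongr
      have h2 : (s * A ^ (i + 1)) ^ a ≤ A ^ 2 := by
        have : s * A ^ (i + 1) ≤ A := by
          calc s * A ^ (i + 1) ≤ A⁻¹ ^ i * A ^ (i + 1) := by gcongr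
            _ = A := by rw [pow_succ, ← mul_assoc, e1, one_mul]
        calc (s * A ^ (i + 1)) ^ a ≤ A ^ a := by gcongr
          _ ≤ A ^ (2 : ℝ) := Real.rpow_le_rpow_of_exponent_le hA1.le (by rw [ha]; linarith)
          _ = A ^ 2 := Real.rpow_two A
      have h3 : c i * (s * A ^ i) ^ b ≤ A ^ 2 * M s * 1 := by gcongr
      have h4 : c (i + 1) * (s * A ^ (i + 1)) ^ a ≤ M s * A ^ 2 := by gcongr
      rw [div_le_iff₀ (by norm_num)]
      linarith
    · have h1 : t s (i + 1) ≤ N₀ s := (hmain s hs.1).1.le_tsum _ fun j _ => htn s hs.1 j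
      have hr : 1 ≤ (s * A ^ (i + 1)) ^ b := by
        refine Real.one_le_rpow ?_ hb0.le
        rw [← e2]; gcongr
      have h2 : 1 ≤ 5 / 2 * shiftPow (a / b) ((s * A ^ (i + 1)) ^ b) :=
        (le_min hr (Real.one_le_rpow hr (by positivity))).trans
          (min_le_shiftPow hθ hθ1 (by positivity))
      have h3 : M s ≤ A ^ 2 * c (i + 1) := by
        refine le_trans (hM.mono hs0.le hi2) ?_
        have := (hcgap i).2
        have : 0 ≤ A ^ 2 * c (i + 1) := by have := hc0 (i + 1); positivity
        change c i ≤ _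
        linarith
      have h4 : c (i + 1) ≤ 5 / 2 * t s (i + 1) := by
        have := mul_le_mul_of_nonneg_left h2 (hc0 (i + 1)).le
        simp only [t]; linarith
      nlinarith [sq_nonneg A]
  have hN0 : N₀ 0 = 0 := by
    simp [N₀, t, shiftPow, Real.zero_rpow hb0.ne']
  have hNpos : ∀ s, 0 < s → 0 < N₀ s := fun s hs => by
    refine (hmain s hs.le).1.tsum_pos (htn s hs.le) 0 (mul_pos (hc0 0) ?_)
    have h1 := min_le_shiftPow hθ hθ1 (u := (s * A ^ 0) ^ b) (by positivity)
    have : 0 < min ((s * A ^ 0) ^ b) (((s * A ^ 0) ^ b) ^ (a / b)) := by positivity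
    linarith
  have hZ := hNpos 1 one_pos
  have hpc : IsPowConvex a (fun s => N₀ s / N₀ 1) := by
    refine ⟨by rw [ha]; linarith, ?_⟩
    have h1 : ConvexOn ℝ (Ici 0) fun x : ℝ => N₀ (x ^ (1 / a)) :=
      convexOn_tsum (convex_Ici 0)
        (fun j => (convexOn_shiftPow_comp ha0 hab (by positivity)).smul (hc0 j).le)
        fun x hx => (hmain _ (Real.rpow_nonneg hx _)).1
    refine (h1.smul (inv_nonneg.2 hZ.le)).congr fun x _ => ?_
    simp only [smul_eq_mul, div_eq_inv_mul]
  refine ⟨ε, hε0, fun s => N₀ s / N₀ 1,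
    isOrliczFunction_of_isPowConvex hpc (by simp [hN0]) (div_self hZ.ne')
      fun s hs => div_pos (hNpos s hs) hZ, ?_, hpc, by rw [← hb]; linarith [ha ▸ hab], ?_⟩
  · refine equivalentOn_of_le (k₁ := 1 / (5 / 2 * A ^ 2 * N₀ 1)) (k₂ := 8 * A ^ 2 / N₀ 1)
      (by positivity) (by positivity) (fun s hs => hM.nonneg hs.1) (fun s hs => ?_) fun s hs => ?_
    · rcases hs.1.eq_or_lt with rfl | hs0
      · simp [hM.map_zero, hN0]
      · have := (hup s hs hs0).2
        rw [one_div_mul_eq_div, div_le_div_iff₀ (by positivity) hZ]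
        nlinarith
    · rcases hs.1.eq_or_lt with rfl | hs0
      · simp [hM.map_zero, hN0]
      · have := (hup s hs hs0).1
        rw [div_mul_eq_mul_div]
        gcongr
  · have h1 : ConcaveOn ℝ (Ici 0) fun x : ℝ => N₀ (x ^ (1 / b)) :=
      concaveOn_tsum (convex_Ici 0)
        (fun j => (concaveOn_shiftPow_comp ha0 hab (by positivity)).smul (hc0 j).le)
        fun x hx => (hmain _ (Real.rpow_nonneg hx _)).1
    refine (h1.smul (inv_nonneg.2 hZ.le)).congr fun x _ => ?_
    exact (div_eq_inv_mul _ _).symm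
end

/-! ### Distribution functions and modulars -/

section
variable {p : ℝ} {M : ℝ → ℝ}

lemma IsOrliczFunction.invFunOn_mem (hM : IsOrliczFunction M) {u : ℝ} (hu : 0 ≤ u) :
    0 ≤ Function.invFunOn M (Ici 0) u ∧ M (Function.invFunOn M (Ici 0) u) = u := by
  have h : ∃ a ∈ Ici (0 : ℝ), M a = u := hM.bijOn.surjOn (mem_Ici.2 hu)
  exact ⟨Function.invFunOn_mem h, Function.invFunOn_eq h⟩

lemma measurable_invRecip (hM : IsOrliczFunction M) : Measurable (invRecip M) := by
  have hmono : Monotone fun u : unitInterval => Function.invFunOn M (Ici 0) (u : ℝ) := by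
    intro u v huv
    obtain ⟨hu0, hu⟩ := hM.invFunOn_mem u.2.1
    obtain ⟨hv0, hv⟩ := hM.invFunOn_mem v.2.1
    by_contra hlt
    have := hM.strictMonoOn (mem_Ici.2 hv0) (mem_Ici.2 hu0) (not_le.1 hlt)
    rw [hu, hv] at this
    exact absurd huv (not_le.2 this)
  exact measurable_const.div hmono.measurable

/-- At `u = 0` the function `invRecip M` takes the value `1 / 0 = 0`; this is a null set. -/
lemma distrFun_invRecip (hM : IsOrliczFunction M) {τ : ℝ} (hτ : 1 ≤ τ) :
    distrFun (invRecip M) τ = M τ⁻¹ := by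
  have hτ0 : 0 < τ := by linarith
  have hx : M τ⁻¹ ∈ Icc (0 : ℝ) 1 :=
    ⟨hM.nonneg (by positivity), hM.le_one (by positivity) (inv_le_one_of_one_le₀ hτ)⟩
  have hset : {u : unitInterval | τ < |invRecip M u|} = Ioo 0 ⟨M τ⁻¹, hx⟩ := by
    ext u
    obtain ⟨hg0, hg⟩ := hM.invFunOn_mem u.2.1
    simp only [mem_ofPred_eq, invRecip, mem_Ioo]
    rw [abs_of_nonneg (by positivity), ← Subtype.coe_lt_coe, ← Subtype.coe_lt_coe]
    set g := Function.invFunOn M (Ici 0) (u : ℝ)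
    change τ < 1 / g ↔ 0 < (u : ℝ) ∧ (u : ℝ) < M τ⁻¹
    rw [← hg]
    rcases hg0.eq_or_lt with h | h
    · simp [← h, hM.map_zero, hτ0.le]
    · rw [hM.strictMonoOn.lt_iff_lt (mem_Ici.2 h.le) (mem_Ici.2 (by positivity)), one_div,
        lt_inv_comm₀ hτ0 h]
      exact ⟨fun h' => ⟨hM.pos h, h'⟩, fun h' => h'.2⟩
  rw [distrFun, hset, Measure.real, unitInterval.volume_Ioo]
  simp [hx.1]

lemma modular_eq_toReal (hp1 : 1 ≤ p) {f : unitInterval → ℝ} (hf : AEMeasurable f) (s : ℝ) :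
    modular p f s = (∫⁻ u, ENNReal.ofReal (psi p (s * f u))).toReal :=
  integral_eq_lintegral_of_nonneg_ae (Filter.Eventually.of_forall fun _ => psi_nonneg hp1 _)
    ((measurable_psi p).comp_aemeasurable (hf.const_mul s)).aestronglyMeasurable

/-- A pointwise bound of a finite sum of indicators of `{τ i < |x|}` by `ψ(s x)` integrates to a
bound of the distribution function by the modular. -/
lemma sum_mul_distrFun_le (hp1 : 1 ≤ p) (hp2 : p ≤ 2) {f : unitInterval → ℝ}
    (hf : MemLp f (ENNReal.ofReal p) volume) (n : ℕ) (w τ : ℕ → ℝ) {K s : ℝ}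
    (h : ∀ x : ℝ, ∑ i ∈ Finset.range n, (if τ i < |x| then w i else 0) ≤ K * psi p (s * x)) :
    ∑ i ∈ Finset.range n, w i * distrFun f (τ i) ≤ K * modular p f s := by
  have hnull : ∀ i, NullMeasurableSet {u | τ i < |f u|} volume := fun i =>
    nullMeasurableSet_lt aemeasurable_const hf.1.aemeasurable.abs
  have hint : ∀ i, Integrable ({u | τ i < |f u|}.indicator fun _ => w i)
      (volume : Measure unitInterval) :=
    fun i => (integrable_const _).indicator₀ (hnull i)
  calc ∑ i ∈ Finset.range n, w i * distrFun f (τ i)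
      = ∑ i ∈ Finset.range n, ∫ u, {u | τ i < |f u|}.indicator (fun _ => w i) u := by
        refine Finset.sum_congr rfl fun i _ => ?_
        rw [integral_indicator₀ (hnull i), setIntegral_const, smul_eq_mul, mul_comm]
        rfl
    _ = ∫ u, ∑ i ∈ Finset.range n, {u | τ i < |f u|}.indicator (fun _ => w i) u :=
        (integral_finsetSum _ fun i _ => hint i).symm
    _ ≤ ∫ u, K * psi p (s * f u) := by
        refine integral_mono (integrable_finsetSum _ fun i _ => hint i)
          ((integrable_psi hp1 hp2 (hf.const_mul s)).const_mul K) fun u => ?_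
        simpa [indicator_apply] using h (f u)
    _ = K * modular p f s := integral_const_mul _ _

lemma distrFun_le_modular (hp1 : 1 ≤ p) (hp2 : p ≤ 2) {f : unitInterval → ℝ}
    (hf : MemLp f (ENNReal.ofReal p) volume) {τ : ℝ} (hτ : 0 < τ) :
    distrFun f τ ≤ 5 / 2 * modular p f τ⁻¹ := by
  have := sum_mul_distrFun_le hp1 hp2 hf 1 (fun _ => 1) (fun _ => τ) (K := 5 / 2) (s := τ⁻¹)
    (fun x => by
      simp only [Finset.range_one, Finset.sum_singleton]
      split_ifs with h
      · refine one_le_psi hp1 hp2 ?_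
        rw [abs_mul, abs_of_pos (inv_pos.2 hτ), le_inv_mul_iff₀ hτ]
        linarith
      · have := psi_nonneg hp1 (τ⁻¹ * x)
        positivity)
  simpa using this

/-- Layer-cake estimate along a sequence of levels increasing from `1` to `∞`. -/
lemma lintegral_le_tsum_levels {f : unitInterval → ℝ} (hf : AEMeasurable f) {g : ℝ → ℝ}
    (hg : ∀ ⦃x y⦄, 0 ≤ x → x ≤ y → g x ≤ g y) {x : ℕ → ℝ}
    (hx0 : x 0 = 1) (hx : ∀ K, ∃ j, K < x j) :
    ∫⁻ u, ENNReal.ofReal (g |f u|) ≤ ENNReal.ofReal (g 1) +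
      ∑' j, ENNReal.ofReal (g (x (j + 1))) * ENNReal.ofReal (distrFun f (x j)) := by
  have hnull : ∀ j, NullMeasurableSet {u | x j < |f u|} volume := fun j =>
    nullMeasurableSet_lt aemeasurable_const hf.abs
  calc ∫⁻ u, ENNReal.ofReal (g |f u|)
      ≤ ∫⁻ u, (ENNReal.ofReal (g 1) + ∑' j,
          {u | x j < |f u|}.indicator (fun _ => ENNReal.ofReal (g (x (j + 1)))) u) := by
        refine lintegral_mono fun u => ?_
        rcases le_or_gt |f u| 1 with h1 | h1
        · exact (ENNReal.ofReal_le_ofReal (hg (abs_nonneg _) h1)).trans le_self_add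
        · classical
          -- the first level at or above `|f u|`
          have hex : ∃ j, |f u| ≤ x j := (hx |f u|).imp fun j hj => hj.le
          obtain ⟨k, hk⟩ : ∃ k, Nat.find hex = k + 1 := by
            refine Nat.exists_eq_succ_of_ne_zero fun h => ?_
            have := Nat.find_spec hex
            rw [h, hx0] at this
            linarith
          have hk1 : |f u| ≤ x (k + 1) := hk ▸ Nat.find_spec hex
          have hk2 : x k < |f u| := not_le.1 (Nat.find_min hex (by omega))
          refine le_trans ?_ le_add_self
          refine le_trans ?_ (ENNReal.le_tsum k)
          rw [indicator_of_mem (show u ∈ {u | x k < |f u|} from hk2)]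
          exact ENNReal.ofReal_le_ofReal (hg (abs_nonneg _) hk1)
    _ = _ := by
        rw [lintegral_add_left measurable_const, lintegral_tsum
          fun j => aemeasurable_const.indicator₀ (hnull j)]
        simp only [lintegral_const, measure_univ, mul_one]
        congr 1
        refine tsum_congr fun j => ?_
        rw [lintegral_indicator_const₀ (hnull j), distrFun, ofReal_measureReal]

/-! ### Partitions adapted to an Orlicz function -/

/-- A sequence of levels `1 = x 0, x 1, …`, unbounded, along which `M (1 / x) x ^ p` at least halves
and `M (1 / x) x ^ 2` at least doubles. -/
structure IsGapPartition (p : ℝ) (M : ℝ → ℝ) (x : ℕ → ℝ) : Prop where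
  zero : x 0 = 1
  one_le : ∀ j, 1 ≤ x j
  unbounded : ∀ K, ∃ j, K < x j
  halve : ∀ j, M (x (j + 1))⁻¹ * x (j + 1) ^ p ≤ 1 / 2 * (M (x j)⁻¹ * x j ^ p)
  double : ∀ j, M (x j)⁻¹ * x j ^ 2 ≤ 1 / 2 * (M (x (j + 1))⁻¹ * x (j + 1) ^ 2)

lemma IsGapPartition.exists_index {x : ℕ → ℝ} (hx : IsGapPartition p M x) {s : ℝ} (hs : 0 < s)
    (hs1 : s ≤ 1) : ∃ i, s * x i ≤ 1 ∧ 1 < s * x (i + 1) := by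
  classical
  have hex : ∃ j, 1 < s * x j := (hx.unbounded s⁻¹).imp fun j hj => by
    rwa [inv_lt_iff_one_lt_mul₀' hs] at hj
  obtain ⟨k, hk⟩ : ∃ k, Nat.find hex = k + 1 := by
    refine Nat.exists_eq_succ_of_ne_zero fun h => ?_
    have := Nat.find_spec hex
    rw [h, hx.zero] at this
    linarith
  exact ⟨k, not_lt.1 (Nat.find_min hex (by omega)), hk ▸ Nat.find_spec hex⟩

/-- `2`-concavity in the form: `M s / s ^ 2` is nonincreasing. -/
lemma mul_sq_le_of_powConcave (hM : IsOrliczFunction M) (hconc : IsPowConcave 2 M) {s y : ℝ}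
    (hs : 0 ≤ s) (hy : 0 < y) (hsy : s * y ≤ 1) : M y⁻¹ * (s * y) ^ 2 ≤ M s := by
  have := hconc.rpow_mul_le hM.map_zero (l := s * y) (t := y⁻¹) (by positivity) hsy (by positivity)
  rw [mul_inv_cancel_right₀ hy.ne', Real.rpow_two] at this
  linarith

lemma le_mul_sq_of_powConcave (hM : IsOrliczFunction M) (hconc : IsPowConcave 2 M) {s y : ℝ}
    (hy : 0 < y) (hsy : 1 ≤ s * y) : M s ≤ M y⁻¹ * (s * y) ^ 2 := by
  have := mul_le_sq_mul hM hconc (A := s * y) (s := y⁻¹) hsy (by positivity)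
  rw [mul_inv_cancel_right₀ hy.ne'] at this
  linarith

/-- `p`-convexity in the form: `M s / s ^ p` is nondecreasing. -/
lemma mul_rpow_le_of_powConvex (hM : IsOrliczFunction M) (hconv : IsPowConvex p M) {s y : ℝ}
    (hy : 0 < y) (hsy : 1 ≤ s * y) : M y⁻¹ * (s * y) ^ p ≤ M s := by
  have := rpow_mul_le_of_powConvex hM hconv (A := s * y) (s := y⁻¹) hsy (by positivity)
  rw [mul_inv_cancel_right₀ hy.ne'] at this
  linarith

lemma le_mul_rpow_of_powConvex (hM : IsOrliczFunction M) (hconv : IsPowConvex p M) {s y : ℝ}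
    (hs : 0 ≤ s) (hy : 0 < y) (hsy : s * y ≤ 1) : M s ≤ M y⁻¹ * (s * y) ^ p := by
  have := hconv.le_rpow_mul hM.map_zero (l := s * y) (t := y⁻¹) (by positivity) hsy (by positivity)
  rw [mul_inv_cancel_right₀ hy.ne'] at this
  linarith

/-- At every scale `s` the terms of `∑ M (1 / x j) ψ(s x j)` decay geometrically away from the level
closest to `1 / s`, where they are at most `M s`. -/
lemma IsGapPartition.summable_and_tsum_le (hp1 : 1 ≤ p) (hp2 : p ≤ 2) (hM : IsOrliczFunction M)
    (hconv : IsPowConvex p M) (hconc : IsPowConcave 2 M) {x : ℕ → ℝ} (hx : IsGapPartition p M x)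
    {s : ℝ} (hs : 0 < s) (hs1 : s ≤ 1) : (Summable fun j => M (x j)⁻¹ * psi p (s * x j)) ∧
      ∑' j, M (x j)⁻¹ * psi p (s * x j) ≤ 4 * M s := by
  have hx0 : ∀ j, 0 < x j := fun j => by linarith [hx.one_le j]
  have hc : ∀ j, 0 < M (x j)⁻¹ := fun j => hM.pos (inv_pos.2 (hx0 j))
  obtain ⟨hsum, hle⟩ := summable_and_tsum_le_of_geometric (q := 1 / 2)
    (t := fun j => M (x j)⁻¹ * psi p (s * x j)) (u := fun j => M (x j)⁻¹ * (s * x j) ^ p)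
    (v := fun j => M (x j)⁻¹ * (s * x j) ^ 2) (by norm_num) (by norm_num)
    (fun j => mul_nonneg (hc j).le (psi_nonneg hp1 _))
    (fun j => by
      have := psi_le_rpow hp1 hp2 (s * x j)
      rw [abs_of_pos (mul_pos hs (hx0 j))] at this
      exact mul_le_mul_of_nonneg_left this (hc j).le)
    (fun j => mul_le_mul_of_nonneg_left (psi_le_sq hp1 hp2 _) (hc j).le)
    (fun j => by
      have := mul_le_mul_of_nonneg_left (hx.halve j) (by positivity : 0 ≤ s ^ p)
      rw [Real.mul_rpow hs.le (hx0 _).le, Real.mul_rpow hs.le (hx0 _).le]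
      linarith)
    (fun j => by
      have := mul_le_mul_of_nonneg_left (hx.double j) (by positivity : 0 ≤ s ^ 2)
      rw [mul_pow, mul_pow]
      linarith)
  refine ⟨hsum, ?_⟩
  obtain ⟨i, hi1, hi2⟩ := hx.exists_index hs hs1
  have h1 := mul_sq_le_of_powConcave hM hconc hs.le (hx0 i) hi1
  have h2 := mul_rpow_le_of_powConvex hM hconv (hx0 (i + 1)) hi2.le
  refine (hle i).trans ?_
  rw [div_le_iff₀ (by norm_num)]
  linarith

lemma PowGap.isGapPartition {A : ℝ} (hA1 : 1 < A)
    (hgap : ∀ s, 0 < s → A * s ≤ 1 →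
      A ^ p * M s ≤ 1 / 2 * M (A * s) ∧ M (A * s) ≤ 1 / 2 * A ^ 2 * M s) :
    IsGapPartition p M fun j => A ^ j := by
  have hA0 : 0 < A := by linarith
  have hcA : ∀ j, A * (A ^ (j + 1))⁻¹ = (A ^ j)⁻¹ := fun j => by
    rw [pow_succ']; field_simp
  have h := fun j => hgap (A ^ (j + 1))⁻¹ (by positivity) (by
      rw [hcA]; exact inv_le_one_of_one_le₀ (one_le_pow₀ hA1.le))
  simp only [hcA] at h
  refine ⟨pow_zero A, fun j => one_le_pow₀ hA1.le, fun K => pow_unbounded_of_one_lt K hA1,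
    fun j => ?_, fun j => ?_⟩
  · have h1 : (A ^ (j + 1)) ^ p = A ^ p * (A ^ j) ^ p := by
      rw [← Real.mul_rpow hA0.le (by positivity), pow_succ']
    have := mul_le_mul_of_nonneg_right (h j).1 (by positivity : 0 ≤ (A ^ j) ^ p)
    rw [h1]
    linarith
  · have := mul_le_mul_of_nonneg_right (h j).2 (by positivity : 0 ≤ (A ^ j) ^ 2)
    have h1 : (A ^ (j + 1)) ^ 2 = A ^ 2 * (A ^ j) ^ 2 := by ring
    rw [h1]
    linarith

/-! ### Random variables distributed like `1 / M⁻¹` -/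

/-- Under the gap condition, a variable with tail `M (1 / τ)` has modular at most a multiple
of `M`. -/
lemma PowGap.lintegral_psi_le (hp1 : 1 ≤ p) (hp2 : p ≤ 2) (hM : IsOrliczFunction M)
    (hconv : IsPowConvex p M) (hconc : IsPowConcave 2 M) (h : PowGap p M (1 / 2)) :
    ∃ K, 0 < K ∧ ∀ f : unitInterval → ℝ, AEMeasurable f →
      (∀ τ, 1 ≤ τ → distrFun f τ = M τ⁻¹) → ∀ s, 0 < s → s ≤ 1 →
        ∫⁻ u, ENNReal.ofReal (psi p (s * f u)) ≤ ENNReal.ofReal (K * M s) := by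
  obtain ⟨A, hA1, hgap⟩ := h
  have hA0 : 0 < A := by linarith
  have hpart := PowGap.isGapPartition hA1 hgap
  refine ⟨1 + 10 * A ^ 2, by positivity, fun f hf hdist s hs hs1 => ?_⟩
  obtain ⟨hsum, hle⟩ := hpart.summable_and_tsum_le hp1 hp2 hM hconv hconc hs hs1
  have h1 := lintegral_le_tsum_levels hf (g := fun x => psi p (s * x)) (x := fun j => A ^ j)
    (fun x y hx hxy => psi_mono hp1 (by
      rw [abs_of_nonneg (mul_nonneg hs.le hx), abs_of_nonneg (mul_nonneg hs.le (hx.trans hxy))]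
      gcongr))
    hpart.zero hpart.unbounded
  have h2 : ∀ u, psi p (s * |f u|) = psi p (s * f u) := fun u => by
    rw [← psi_abs, abs_mul, abs_abs, ← abs_mul, psi_abs]
  simp only [h2, mul_one] at h1
  refine h1.trans ?_
  have h3 : ∀ j, ENNReal.ofReal (psi p (s * A ^ (j + 1))) * ENNReal.ofReal (distrFun f (A ^ j))
      ≤ ENNReal.ofReal (5 / 2 * A ^ 2 * (M (A ^ j)⁻¹ * psi p (s * A ^ j))) := fun j => by
    rw [← ENNReal.ofReal_mul (psi_nonneg hp1 _), hdist _ (one_le_pow₀ hA1.le)]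
    refine ENNReal.ofReal_le_ofReal ?_
    have h4 := psi_mul_le hp1 hp2 hA1.le (s * A ^ j)
    rw [show A * (s * A ^ j) = s * A ^ (j + 1) by ring] at h4
    have h5 := mul_le_mul_of_nonneg_right h4 (hM.nonneg (by positivity : 0 ≤ (A ^ j)⁻¹))
    linarith
  have h4 : psi p s ≤ M s := by
    have := mul_sq_le_of_powConcave hM hconc hs.le one_pos (by simpa using hs1)
    simp only [inv_one, hM.map_one, mul_one, one_mul] at this
    exact (psi_le_sq hp1 hp2 s).trans this
  calc _ ≤ ENNReal.ofReal (M s) +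
        ∑' j, ENNReal.ofReal (5 / 2 * A ^ 2 * (M (A ^ j)⁻¹ * psi p (s * A ^ j))) :=
        add_le_add (ENNReal.ofReal_le_ofReal h4) (ENNReal.tsum_le_tsum h3)
    _ = ENNReal.ofReal (M s + 5 / 2 * A ^ 2 * ∑' j, M (A ^ j)⁻¹ * psi p (s * A ^ j)) := by
        have hn : ∀ j, 0 ≤ M (A ^ j)⁻¹ * psi p (s * A ^ j) := fun j =>
          mul_nonneg (hM.nonneg (by positivity)) (psi_nonneg hp1 _)
        rw [← ENNReal.ofReal_tsum_of_nonneg (fun j => mul_nonneg (by positivity) (hn j))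
          (hsum.mul_left _), tsum_mul_left, ENNReal.ofReal_add (hM.nonneg hs.le)
          (mul_nonneg (by positivity) (tsum_nonneg hn))]
    _ ≤ _ := by
        refine ENNReal.ofReal_le_ofReal ?_
        have := mul_le_mul_of_nonneg_left hle (by positivity : 0 ≤ 5 / 2 * A ^ 2)
        linarith

theorem PowGap.invRecipSpans (hp1 : 1 ≤ p) (hp2 : p ≤ 2) (hM : IsOrliczFunction M)
    (hconv : IsPowConvex p M) (hconc : IsPowConcave 2 M) (h : PowGap p M (1 / 2)) :
    InvRecipSpans p M := by
  obtain ⟨K, hK, hle⟩ := h.lintegral_psi_le hp1 hp2 hM hconv hconc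
  refine ⟨?_, fun f F hf hfm hF => ?_⟩
  · have hm := measurable_invRecip hM
    refine memLp_of_lintegral_lt_top hp1 hm.aemeasurable ?_
    have h1 := hle _ hm.aemeasurable (fun τ hτ => distrFun_invRecip hM hτ) 1 one_pos le_rfl
    calc ∫⁻ u, ENNReal.ofReal (|invRecip M u| ^ p)
        ≤ ∫⁻ u, (ENNReal.ofReal (psi p (1 * invRecip M u)) + 1) := by
          refine lintegral_mono fun u => ?_
          rw [← ENNReal.ofReal_one, ← ENNReal.ofReal_add (psi_nonneg hp1 _) zero_le_one, one_mul]
          exact ENNReal.ofReal_le_ofReal (rpow_le_psi_add_one hp1 _)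
      _ = (∫⁻ u, ENNReal.ofReal (psi p (1 * invRecip M u))) + 1 := by
          rw [lintegral_add_right _ measurable_const]; simp
      _ < ⊤ := ENNReal.add_lt_top.2 ⟨h1.trans_lt ENNReal.ofReal_lt_top, ENNReal.one_lt_top⟩
  · have hdist : ∀ τ, 1 ≤ τ → distrFun f τ = M τ⁻¹ := fun τ hτ => by
      rw [hfm τ (by linarith), distrFun_invRecip hM hτ]
    refine equivUnitVectorBasis_of_equivalentOn hp1 hp2 hM hf hF ?_
    refine equivalentOn_of_le (k₁ := 2 / 5) (k₂ := K) (by norm_num) hK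
      (fun s hs => hM.nonneg hs.1) (fun s hs => ?_) fun s hs => ?_
    · rcases hs.1.eq_or_lt with rfl | hs0
      · simp [modular, hM.map_zero, psi_zero]
      · have := distrFun_le_modular hp1 hp2 hf.1 (inv_pos.2 hs0)
        rw [hdist _ ((one_le_inv₀ hs0).2 hs.2), inv_inv] at this
        linarith
    · rcases hs.1.eq_or_lt with rfl | hs0
      · simp [modular, hM.map_zero, psi_zero]
      · rw [modular_eq_toReal hp1 hf.1.1.aemeasurable]
        exact ENNReal.toReal_le_of_le_ofReal (mul_nonneg hK.le (hM.nonneg hs.1))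
          (hle f hf.1.1.aemeasurable hdist s hs0 hs.2)

lemma sum_rpow_indicator_le (hp1 : 1 ≤ p) (n : ℕ) {x : ℝ} (hx : 0 ≤ x) :
    ∑ i ∈ Finset.range n, (if (2 : ℝ) ^ i < x then ((2 : ℝ) ^ i) ^ p else 0) ≤ 2 * x ^ p := by
  induction n with
  | zero => simp; positivity
  | succ n ih =>
    rw [Finset.sum_range_succ]
    split_ifs with h
    · have hgeo : ∀ m : ℕ, ∑ i ∈ Finset.range m, ((2 : ℝ) ^ i) ^ p ≤ ((2 : ℝ) ^ m) ^ p := by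
        intro m
        induction m with
        | zero => simp
        | succ m ihm =>
          rw [Finset.sum_range_succ, pow_succ' (2 : ℝ) m,
            Real.mul_rpow (by norm_num) (by positivity)]
          have h2 : (2 : ℝ) ≤ 2 ^ p := by
            simpa using Real.rpow_le_rpow_of_exponent_le (x := 2) (by norm_num) hp1
          have : 0 ≤ ((2 : ℝ) ^ m) ^ p := by positivity
          nlinarith
      have h1 : ∑ i ∈ Finset.range n, (if (2 : ℝ) ^ i < x then ((2 : ℝ) ^ i) ^ p else 0)
          ≤ ∑ i ∈ Finset.range n, ((2 : ℝ) ^ i) ^ p := by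
        refine Finset.sum_le_sum fun i _ => ?_
        split_ifs
        · exact le_rfl
        · positivity
      have h2 : ((2 : ℝ) ^ n) ^ p ≤ x ^ p := by gcongr
      linarith [hgeo n]
    · linarith

lemma sum_inv_four_pow_le (n : ℕ) : ∑ i ∈ Finset.range n, ((4 : ℝ) ^ i)⁻¹ ≤ 2 := by
  have : ∑ i ∈ Finset.range n, ((4 : ℝ) ^ i)⁻¹ ≤ 2 - 2 * ((4 : ℝ) ^ n)⁻¹ := by
    induction n with
    | zero => simp
    | succ n ih =>
      rw [Finset.sum_range_succ, pow_succ, mul_inv]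
      have : 0 < ((4 : ℝ) ^ n)⁻¹ := by positivity
      linarith
  have h0 : 0 < ((4 : ℝ) ^ n)⁻¹ := by positivity
  linarith

lemma sum_inv_four_indicator_le_sq (n : ℕ) (x : ℝ) (hx : 0 ≤ x) :
    ∑ i ∈ Finset.range n, (if ((2 : ℝ) ^ i)⁻¹ < x then ((4 : ℝ) ^ i)⁻¹ else 0) ≤ 2 * x ^ 2 := by
  induction n generalizing x with
  | zero => simp; positivity
  | succ n ih =>
    rcases le_or_gt x 1 with h | h
    · rw [Finset.sum_range_succ']
      have h0 : ¬ (((2 : ℝ) ^ 0)⁻¹ < x) := by simpa using h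
      rw [if_neg h0, add_zero]
      have h1 : ∀ i : ℕ, (if ((2 : ℝ) ^ (i + 1))⁻¹ < x then ((4 : ℝ) ^ (i + 1))⁻¹ else 0)
          = 1 / 4 * (if ((2 : ℝ) ^ i)⁻¹ < 2 * x then ((4 : ℝ) ^ i)⁻¹ else 0) := fun i => by
        have : ((2 : ℝ) ^ (i + 1))⁻¹ < x ↔ ((2 : ℝ) ^ i)⁻¹ < 2 * x := by
          rw [pow_succ, mul_inv]
          constructor <;> intro h <;> linarith
        simp only [this]
        split_ifs
        · rw [pow_succ, mul_inv]; ring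
        · simp
      simp only [h1]
      rw [← Finset.mul_sum]
      have := ih (2 * x) (by positivity)
      linarith
    · refine le_trans (Finset.sum_le_sum fun i _ => ?_) ((sum_inv_four_pow_le (n + 1)).trans ?_)
      · split_ifs
        · exact le_rfl
        · positivity
      · nlinarith

/-- If a variable with tail `M (1 / τ)` has modular at most a multiple of `M`, then summing the
contributions of many dyadic layers forces both ratios in the gap condition to be small. -/
theorem powGap_of_modular_le (hp1 : 1 ≤ p) (hp2 : p ≤ 2) (hM : IsOrliczFunction M)
    (hconv : IsPowConvex p M) (hconc : IsPowConcave 2 M) {f : unitInterval → ℝ}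
    (hf : MemLp f (ENNReal.ofReal p) volume) (hdist : ∀ τ, 1 ≤ τ → distrFun f τ = M τ⁻¹)
    {C : ℝ} (hC : 0 < C) (h : ∀ s, 0 < s → s ≤ 1 → modular p f s ≤ C * M s) :
    PowGap p M (1 / 2) := by
  obtain ⟨n, hn⟩ := exists_nat_ge (10 * C + 1)
  have hn0 : n ≠ 0 := by rintro rfl; norm_num at hn; linarith
  refine ⟨2 ^ n, one_lt_pow₀ (by norm_num) hn0, fun s hs hs1 => ⟨?_, ?_⟩⟩
  · set t := (2 : ℝ) ^ n * s with ht
    have ht0 : 0 < t := by positivity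
    have key := sum_mul_distrFun_le hp1 hp2 hf n (fun i => ((2 : ℝ) ^ i) ^ p)
      (fun i => 2 ^ i / t) (K := 5) (s := t) (fun x => by
        have h1 : ∀ i : ℕ, (2 : ℝ) ^ i / t < |x| ↔ (2 : ℝ) ^ i < |t * x| := fun i => by
          rw [abs_mul, abs_of_pos ht0, div_lt_iff₀' ht0]
        simp only [h1]
        rcases le_total |t * x| 1 with h2 | h2
        · refine le_trans (Finset.sum_nonpos fun i _ => ?_)
            (mul_nonneg (by norm_num) (psi_nonneg hp1 _))
          rw [if_neg]
          exact not_lt.2 (h2.trans (one_le_pow₀ (by norm_num)))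
        · refine (sum_rpow_indicator_le hp1 n (abs_nonneg _)).trans ?_
          have := rpow_le_psi hp1 hp2 h2
          linarith)
    have hlow : ∀ i ∈ Finset.range n,
        ((2 : ℝ) ^ n) ^ p * M s ≤ ((2 : ℝ) ^ i) ^ p * distrFun f (2 ^ i / t) := by
      intro i hi
      have hin : i ≤ n := (Finset.mem_range.1 hi).le
      rw [hdist _ (by rw [le_div_iff₀ ht0, one_mul]; exact hs1.trans (one_le_pow₀ (by norm_num)))]
      have e1 : (2 : ℝ) ^ n = 2 ^ i * 2 ^ (n - i) := by rw [← pow_add, Nat.add_sub_cancel' hin]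
      have e2 : (2 ^ i / t)⁻¹ = 2 ^ (n - i) * s := by rw [inv_div, ht, e1]; field_simp
      rw [e2, e1, Real.mul_rpow (by positivity) (by positivity), mul_assoc]
      have := rpow_mul_le_of_powConvex hM hconv (A := 2 ^ (n - i)) (s := s)
        (one_le_pow₀ (by norm_num)) hs.le
      gcongr
    have h1 := Finset.sum_le_sum hlow
    rw [Finset.sum_const, Finset.card_range, nsmul_eq_mul] at h1
    have h2 := h t ht0 hs1
    have h3 : 0 ≤ ((2 : ℝ) ^ n) ^ p * M s := mul_nonneg (by positivity) (hM.nonneg hs.le)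
    have h4 : 10 * C * (((2 : ℝ) ^ n) ^ p * M s) ≤ 5 * (C * M t) :=
      calc 10 * C * (((2 : ℝ) ^ n) ^ p * M s) ≤ n * (((2 : ℝ) ^ n) ^ p * M s) := by
            gcongr; linarith
        _ ≤ 5 * (C * M t) := by linarith
    refine le_of_mul_le_mul_left (a := 10 * C) ?_ (by positivity)
    linarith
  · have key := sum_mul_distrFun_le hp1 hp2 hf n (fun i => ((4 : ℝ) ^ i)⁻¹)
      (fun i => (2 ^ i * s)⁻¹) (K := 5) (s := s) (fun x => by
        have h1 : ∀ i : ℕ, ((2 : ℝ) ^ i * s)⁻¹ < |x| ↔ ((2 : ℝ) ^ i)⁻¹ < |s * x| := fun i => by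
          rw [abs_mul, abs_of_pos hs, mul_inv, mul_comm, inv_mul_lt_iff₀ hs]
        simp only [h1]
        rcases le_total |s * x| 1 with h2 | h2
        · refine (sum_inv_four_indicator_le_sq n _ (abs_nonneg _)).trans ?_
          have := sq_le_psi hp1 hp2 h2
          rw [sq_abs]
          linarith
        · refine le_trans (Finset.sum_le_sum fun i _ => ?_)
            ((sum_inv_four_pow_le n).trans ?_)
          · split_ifs
            · exact le_rfl
            · positivity
          · have := one_le_psi hp1 hp2 h2
            linarith)
    have hlow : ∀ i ∈ Finset.range n,
        ((4 : ℝ) ^ n)⁻¹ * M (2 ^ n * s) ≤ ((4 : ℝ) ^ i)⁻¹ * distrFun f (2 ^ i * s)⁻¹ := by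
      intro i hi
      have hin : i ≤ n := (Finset.mem_range.1 hi).le
      have e1 : ∀ c : ℝ, c ^ n = c ^ (n - i) * c ^ i := fun c => by
        rw [← pow_add, Nat.sub_add_cancel hin]
      have hle1 : (2 : ℝ) ^ i * s ≤ 1 := by
        refine le_trans ?_ hs1
        gcongr
        norm_num
      rw [hdist _ ((one_le_inv₀ (by positivity)).2 hle1), inv_inv, e1 2, mul_assoc]
      have := mul_le_sq_mul hM hconc (A := 2 ^ (n - i)) (s := 2 ^ i * s)
        (one_le_pow₀ (by norm_num)) (by positivity)
      have e3 : ((2 : ℝ) ^ (n - i)) ^ 2 = 4 ^ (n - i) := by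
        rw [← pow_mul, mul_comm, pow_mul]; norm_num
      rw [e3] at this
      rw [e1 4, mul_inv, mul_comm (((4 : ℝ) ^ (n - i))⁻¹), mul_assoc]
      gcongr
      rwa [inv_mul_le_iff₀ (by positivity)]
    have h1 := Finset.sum_le_sum hlow
    rw [Finset.sum_const, Finset.card_range, nsmul_eq_mul] at h1
    have hs1' : s ≤ 1 := by
      have : 1 * s ≤ 2 ^ n * s := by gcongr; exact one_le_pow₀ (by norm_num)
      linarith
    have h2 := h s hs hs1'
    have h3 : 0 ≤ ((4 : ℝ) ^ n)⁻¹ * M (2 ^ n * s) :=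
      mul_nonneg (by positivity) (hM.nonneg (by positivity))
    have h4 : 10 * C * (((4 : ℝ) ^ n)⁻¹ * M (2 ^ n * s)) ≤ 5 * (C * M s) :=
      calc 10 * C * (((4 : ℝ) ^ n)⁻¹ * M (2 ^ n * s)) ≤ n * (((4 : ℝ) ^ n)⁻¹ * M (2 ^ n * s)) := by
            gcongr; linarith
        _ ≤ 5 * (C * M s) := by linarith
    have e3 : ((2 : ℝ) ^ n) ^ 2 = 4 ^ n := by
      rw [← pow_mul, mul_comm, pow_mul]; norm_num
    have h5 : ((4 : ℝ) ^ n)⁻¹ * M (2 ^ n * s) ≤ 1 / 2 * M s := by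
      refine le_of_mul_le_mul_left (a := 10 * C) ?_ (by positivity)
      linarith
    rw [inv_mul_le_iff₀ (by positivity)] at h5
    rw [e3]
    linarith
end

section
variable {p : ℝ} {M : ℝ → ℝ}

/-- Applied to a symmetric variable whose modulus is distributed like `1 / M⁻¹`. -/
theorem InvRecipSpans.powGap (hp1 : 1 ≤ p) (hp2 : p ≤ 2) (hM : IsOrliczFunction M)
    (hconv : IsPowConvex p M) (hconc : IsPowConcave 2 M) (h : InvRecipSpans p M) :
    PowGap p M (1 / 2) := by
  have hm := measurable_invRecip hM
  have : IsProbabilityMeasure ((volume : Measure unitInterval).map (invRecip M)) :=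
    Measure.isProbabilityMeasure_map hm.aemeasurable
  obtain ⟨f, F, hfm, hf, hF, hlaw⟩ := exists_indepCopies_of_law hp1
    ((volume : Measure unitInterval).map (invRecip M)) (by
      rw [lintegral_map (by fun_prop) hm]
      have := (integrable_abs_rpow hp1 h.1).lintegral_lt_top
      exact this)
  have heq : Equimeasurable f (invRecip M) := by
    intro τ _
    have h1 := hlaw ((Ioi τ).indicator 1) (measurable_one.indicator measurableSet_Ioi)
    have hg : Measurable fun x : ℝ => (Ioi τ).indicator (1 : ℝ → ENNReal) |x| :=
      (measurable_one.indicator measurableSet_Ioi).comp measurable_abs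
    rw [lintegral_map hg hm] at h1
    have h2 : ∀ g : unitInterval → ℝ, Measurable g →
        ∫⁻ u, (Ioi τ).indicator (1 : ℝ → ENNReal) |g u| = volume {u | τ < |g u|} := by
      intro g hg
      rw [← lintegral_indicator_one (measurableSet_lt measurable_const hg.abs)]
      rfl
    have h3 := (h2 f hfm).symm.trans (h1.trans (h2 _ hm))
    rw [distrFun, distrFun, Measure.real, Measure.real, h3]
  have hdist : ∀ τ, 1 ≤ τ → distrFun f τ = M τ⁻¹ := fun τ hτ => by
    rw [heq τ (by linarith), distrFun_invRecip hM hτ]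
  obtain ⟨C, hC, hle⟩ := equivalentOn_of_equivUnitVectorBasis hp1 hp2 hM hf hF (h.2 f F hf heq hF)
  exact powGap_of_modular_le hp1 hp2 hM hconv hconc hf.1 hdist hC
    fun s hs hs1 => (hle s ⟨hs.le, hs1⟩).2

/-- If the growth exponents of `M` are strictly between `p` and `2`, the main part of the modular
`E ψ(s f)` comes from values of `|f|` comparable to `1 / s`, so that it determines the tail. -/
theorem hasUniqueDistribution_of_powGap (hp1 : 1 ≤ p) (hp2 : p ≤ 2) (hM : IsOrliczFunction M)
    (hconc : IsPowConcave 2 M) (h : ∀ η, 0 < η → PowGap p M η) : HasUniqueDistribution p M := by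
  intro f F hf hF hequiv
  obtain ⟨D, hD, hle⟩ := equivalentOn_of_equivUnitVectorBasis hp1 hp2 hM hf hF hequiv
  obtain ⟨A, hA1, hgap⟩ := h (1 / (10 * D ^ 2)) (by positivity)
  have hA0 : 0 < A := by linarith
  have hpoint : ∀ s, 0 < s → ∀ x : ℝ,
      (if 1 < |A * s * x| then (A ^ p : ℝ) else 0) +
        5 / 2 * A⁻¹ ^ 2 * psi p (A * s * x) + 5 / 2 * A ^ p * psi p (A⁻¹ * s * x)
          ≥ psi p (s * x) := by
    intro s hs x
    have h0 := psi_nonneg hp1 (A * s * x)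
    have h0' := psi_nonneg hp1 (A⁻¹ * s * x)
    have hAp : 0 ≤ A ^ p := by positivity
    have e1 : A⁻¹ * (A * s * x) = s * x := by field_simp
    have e2 : A * (A⁻¹ * s * x) = s * x := by field_simp
    split_ifs with hx
    · rcases le_total 1 |A⁻¹ * s * x| with hx2 | hx2
      · have := psi_mul_le_rpow hp1 hp2 hA0.le hx2
        rw [e2] at this
        have : 0 ≤ 5 / 2 * A⁻¹ ^ 2 * psi p (A * s * x) := by positivity
        linarith
      · have h1 : |s * x| ≤ A := by
          rw [← e2, abs_mul, abs_of_pos hA0]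
          exact mul_le_of_le_one_right hA0.le hx2
        have h2 : psi p (s * x) ≤ A ^ p := (psi_le_rpow hp1 hp2 _).trans (by gcongr)
        have : 0 ≤ 5 / 2 * A⁻¹ ^ 2 * psi p (A * s * x) := by positivity
        have : 0 ≤ 5 / 2 * A ^ p * psi p (A⁻¹ * s * x) := by positivity
        linarith
    · have := psi_mul_le_sq hp1 hp2 (l := A⁻¹) (not_lt.1 hx)
      rw [e1] at this
      have : 0 ≤ 5 / 2 * A ^ p * psi p (A⁻¹ * s * x) := by positivity
      linarith
  have hint : ∀ s, 0 < s → modular p f s ≤ A ^ p * distrFun f (A * s)⁻¹ +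
      5 / 2 * A⁻¹ ^ 2 * modular p f (A * s) + 5 / 2 * A ^ p * modular p f (A⁻¹ * s) := by
    intro s hs
    have hnull : NullMeasurableSet {u | 1 < |A * s * f u|} (volume : Measure unitInterval) :=
      nullMeasurableSet_lt aemeasurable_const (hf.1.1.aemeasurable.const_mul (A * s)).abs
    have hset : {u | 1 < |A * s * f u|} = {u | (A * s)⁻¹ < |f u|} := by
      ext u
      simp only [mem_ofPred_eq]
      rw [abs_mul, abs_of_pos (by positivity : 0 < A * s),
        inv_lt_iff_one_lt_mul₀' (by positivity : 0 < A * s)]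
    have i1 : Integrable ({u | 1 < |A * s * f u|}.indicator fun _ => (A ^ p : ℝ))
      (volume : Measure unitInterval) := (integrable_const _).indicator₀ hnull
    have i2 := (integrable_psi hp1 hp2 (hf.1.const_mul (A * s))).const_mul (5 / 2 * A⁻¹ ^ 2)
    have i3 := (integrable_psi hp1 hp2 (hf.1.const_mul (A⁻¹ * s))).const_mul (5 / 2 * A ^ p)
    have h1 := integral_mono (integrable_psi hp1 hp2 (hf.1.const_mul s)) ((i1.add i2).add i3)
      fun u => by
        simp only [Pi.add_apply, indicator_apply, mem_ofPred_eq]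
        exact hpoint s hs (f u)
    simp only [Pi.add_apply] at h1
    rw [integral_add (by exact i1.add i2) i3, integral_add i1 i2, integral_const_mul,
      integral_const_mul, integral_indicator₀ hnull, setIntegral_const, smul_eq_mul, hset] at h1
    rw [mul_comm (A ^ p) (distrFun f _)]
    exact h1
  refine ⟨1, one_pos, equivalentOn_of_le (k₁ := 1 / (5 / 2 * D)) (k₂ := 2 * D * A ^ p * A ^ 2)
    (by positivity) (by positivity) (fun τ _ => measureReal_nonneg) (fun τ hτ => ?_) fun τ hτ => ?_⟩
  all_goals
    have hτ1 : 1 ≤ τ := hτ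
    have hτ0 : 0 < τ := by linarith
    have hτi : τ⁻¹ ≤ 1 := inv_le_one_of_one_le₀ hτ1
    rw [distrFun_invRecip hM hτ1]
  · have h1 := distrFun_le_modular hp1 hp2 hf.1 hτ0
    have h2 := (hle τ⁻¹ ⟨by positivity, hτi⟩).2
    rw [one_div_mul_eq_div, div_le_iff₀ (by positivity)]
    linarith
  · -- `s` is chosen so that the relevant level `(A * s)⁻¹` is `τ`
    set s := A⁻¹ * τ⁻¹ with hs
    have hs0 : 0 < s := by positivity
    have hAs : A * s = τ⁻¹ := by rw [hs, mul_inv_cancel_left₀ hA0.ne']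
    have hs1 : s ≤ 1 := by
      have : s ≤ A * s := le_mul_of_one_le_left hs0.le hA1.le
      linarith
    have hAAs : A * (A⁻¹ * s) = s := mul_inv_cancel_left₀ hA0.ne' s
    have hs2 : A⁻¹ * s ≤ 1 := by
      have : A⁻¹ * s ≤ A * (A⁻¹ * s) := le_mul_of_one_le_left (by positivity) hA1.le
      linarith
    have h1 := hint s hs0
    have h2 := (inv_mul_le_iff₀ hD).1 (hle s ⟨hs0.le, hs1⟩).1
    have h3 := (hle (A * s) ⟨by positivity, by rw [hAs]; exact hτi⟩).2
    have h4 := (hle (A⁻¹ * s) ⟨by positivity, hs2⟩).2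
    have h5 := (hgap s hs0 (by rw [hAs]; exact hτi)).2
    have h6 := (hgap (A⁻¹ * s) (by positivity) (by rw [hAAs]; exact hs1)).1
    rw [hAAs] at h6
    have hMs := hM.pos hs0
    have h7 : 5 / 2 * A⁻¹ ^ 2 * modular p f (A * s) ≤ 1 / (4 * D) * M s := by
      calc 5 / 2 * A⁻¹ ^ 2 * modular p f (A * s)
          ≤ 5 / 2 * A⁻¹ ^ 2 * (D * (1 / (10 * D ^ 2) * A ^ 2 * M s)) := by
            gcongr; exact h3.trans (by gcongr)
        _ = 1 / (4 * D) * M s := by field_simp; norm_num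
    have h8 : 5 / 2 * A ^ p * modular p f (A⁻¹ * s) ≤ 1 / (4 * D) * M s := by
      calc 5 / 2 * A ^ p * modular p f (A⁻¹ * s) ≤ 5 / 2 * A ^ p * (D * M (A⁻¹ * s)) := by gcongr
        _ = 5 / 2 * D * (A ^ p * M (A⁻¹ * s)) := by ring
        _ ≤ 5 / 2 * D * (1 / (10 * D ^ 2) * M s) := by gcongr
        _ = 1 / (4 * D) * M s := by field_simp; norm_num
    rw [hAs] at h1 h7
    rw [inv_inv] at h1
    have h9 : M s ≤ 2 * D * (A ^ p * distrFun f τ) := by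
      have h10 : modular p f s ≤ A ^ p * distrFun f τ + 1 / (2 * D) * M s := by
        have : 1 / (2 * D) * M s = 1 / (4 * D) * M s + 1 / (4 * D) * M s := by field_simp; norm_num
        linarith
      have h11 := h2.trans (mul_le_mul_of_nonneg_left h10 hD.le)
      have h12 : D * (1 / (2 * D) * M s) = M s / 2 := by field_simp
      rw [mul_add, h12] at h11
      linarith
    calc M τ⁻¹ ≤ A ^ 2 * M s := by
          rw [← hAs]; exact mul_le_sq_mul hM hconc hA1.le hs0.le
      _ ≤ A ^ 2 * (2 * D * (A ^ p * distrFun f τ)) := by gcongr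
      _ = _ := by ring

/-! ### Constructing a variable with sparse values -/

lemma modular_of_law (hp1 : 1 ≤ p) {μ : Measure ℝ} {f : unitInterval → ℝ} (hf : Measurable f)
    (h : ∀ g : ℝ → ENNReal, Measurable g → ∫⁻ u, g |f u| = ∫⁻ x, g |x| ∂μ) (s : ℝ) :
    modular p f s = (∫⁻ x, ENNReal.ofReal (psi p (s * x)) ∂μ).toReal := by
  have h1 : ∀ x : ℝ, psi p (s * |x|) = psi p (s * x) := fun x => by
    rw [← psi_abs, abs_mul, abs_abs, ← abs_mul, psi_abs]
  have h2 := h (fun x => ENNReal.ofReal (psi p (s * x)))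
    ((measurable_psi p).comp (measurable_const_mul s)).ennreal_ofReal
  simp only [h1] at h2
  rw [modular_eq_toReal hp1 hf.aemeasurable, h2]

/-- Under uniqueness of the distribution `M s / s ^ 2` is unbounded: otherwise `M` is equivalent to
`t ^ 2`, and independent signs, whose distribution function vanishes beyond `1`, are equivalent to
the basis of `l_M`. -/
lemma HasUniqueDistribution.not_le_sq (hp1 : 1 ≤ p) (hp2 : p ≤ 2) (hM : IsOrliczFunction M)
    (hconc : IsPowConcave 2 M) (h : HasUniqueDistribution p M) (K : ℝ) :
    ∃ s, 0 < s ∧ s ≤ 1 ∧ K * s ^ 2 < M s := by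
  by_contra! hK
  have hK1 : 1 ≤ K := by
    have := hK 1 one_pos le_rfl
    rw [hM.map_one] at this
    linarith
  obtain ⟨f, F, hfm, hf, hF, hlaw⟩ := exists_indepCopies_of_law hp1 (Measure.dirac 1) (by
    rw [lintegral_dirac]; exact ENNReal.ofReal_lt_top)
  have hmod : ∀ s, modular p f s = psi p s := fun s => by
    rw [modular_of_law hp1 hfm hlaw, lintegral_dirac, mul_one,
      ENNReal.toReal_ofReal (psi_nonneg hp1 _)]
  have hequiv : EquivalentOn (Icc 0 1) M (modular p f) := by
    refine equivalentOn_of_le (k₁ := 1 / (5 / 2 * K)) (k₂ := 1) (by positivity) one_pos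
      (fun s hs => hM.nonneg hs.1) (fun s hs => ?_) fun s hs => ?_
    all_goals rw [hmod]; rcases hs.1.eq_or_lt with rfl | hs0
    · simp [hM.map_zero, psi_zero]
    · have h1 := hK s hs0 hs.2
      have h2 := sq_le_psi hp1 hp2 (t := s) (by rw [abs_of_pos hs0]; exact hs.2)
      rw [one_div_mul_eq_div, div_le_iff₀ (by positivity)]
      have := mul_le_mul_of_nonneg_left h2 (by linarith : 0 ≤ K)
      linarith
    · simp [hM.map_zero, psi_zero]
    · have h1 := mul_sq_le_of_powConcave hM hconc hs.1 one_pos (by simpa using hs.2)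
      simp only [inv_one, hM.map_one, mul_one, one_mul] at h1
      have := psi_le_sq hp1 hp2 s
      linarith
  obtain ⟨τ₀, -, C, hC, hle⟩ := h f F hf hF
    (equivUnitVectorBasis_of_equivalentOn hp1 hp2 hM hf hF hequiv)
  have hτ : (1 : ℝ) ≤ max τ₀ 1 := le_max_right _ _
  have h1 := (hle (max τ₀ 1) (mem_Ici.2 (le_max_left _ _))).2
  have h2 : distrFun f (max τ₀ 1) = 0 := by
    have h3 := hlaw ((Ioi (max τ₀ 1)).indicator 1) (measurable_one.indicator measurableSet_Ioi)
    rw [lintegral_dirac, abs_one, indicator_of_notMem (by simp)] at h3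
    have h4 : ∫⁻ u, (Ioi (max τ₀ 1)).indicator (1 : ℝ → ENNReal) |f u|
        = volume {u | max τ₀ 1 < |f u|} := by
      rw [← lintegral_indicator_one (measurableSet_lt measurable_const hfm.abs)]
      rfl
    rw [distrFun, Measure.real, ← h4, h3, ENNReal.toReal_zero]
  rw [h2, distrFun_invRecip hM hτ, mul_zero] at h1
  have := hM.pos (inv_pos.2 (by linarith : 0 < max τ₀ 1))
  linarith

/-- If `M` is not equivalent to `t ^ p`, then `M s / s ^ p` takes arbitrarily small values. -/
lemma exists_lt_rpow_of_not_equivalentOn (hp1 : 1 ≤ p) (hM : IsOrliczFunction M)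
    (hconv : IsPowConvex p M) (h : ¬ EquivalentOn (Icc 0 1) M fun t => t ^ p) {δ : ℝ} (hδ : 0 < δ) :
    ∃ s, 0 < s ∧ s ≤ 1 ∧ M s < δ * s ^ p := by
  by_contra! hle
  refine h (equivalentOn_of_le (k₁ := 1) (k₂ := 1 / δ) one_pos (by positivity)
    (fun s hs => hM.nonneg hs.1) (fun s hs => ?_) fun s hs => ?_)
  · have := le_mul_rpow_of_powConvex hM hconv hs.1 one_pos (by simpa using hs.2)
    simpa [hM.map_one] using this
  · rcases hs.1.eq_or_lt with rfl | hs0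
    · simp [hM.map_zero, Real.zero_rpow (by linarith : p ≠ 0)]
    · rw [one_div_mul_eq_div, le_div_iff₀ hδ]
      have := hle s hs0 hs.2
      linarith

/-- A dyadic partition in which every level is the first one at which both ratios have changed by
a factor of two; at each step one of the ratios has then changed by a factor of at most four. -/
lemma exists_isGapPartition (hp1 : 1 ≤ p) (hM : IsOrliczFunction M)
    (hconv : IsPowConvex p M) (hconc : IsPowConcave 2 M)
    (h1 : ∀ K, ∃ s, 0 < s ∧ s ≤ 1 ∧ K * s ^ 2 < M s)
    (h2 : ∀ δ, 0 < δ → ∃ s, 0 < s ∧ s ≤ 1 ∧ M s < δ * s ^ p) :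
    ∃ x : ℕ → ℝ, IsGapPartition p M x ∧ (∀ j, 2 * x j ≤ x (j + 1)) ∧
      ∀ j, M (x j)⁻¹ * x j ^ p ≤ 4 * (M (x (j + 1))⁻¹ * x (j + 1) ^ p) ∨
        M (x (j + 1))⁻¹ * x (j + 1) ^ 2 ≤ 4 * (M (x j)⁻¹ * x j ^ 2) := by
  classical
  let y : ℕ → ℝ := fun n => 2 ^ n
  let r : ℕ → ℝ := fun n => M (y n)⁻¹ * y n ^ p
  let t : ℕ → ℝ := fun n => M (y n)⁻¹ * y n ^ 2
  have hy0 : ∀ n, 0 < y n := fun n => by positivity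
  have hy1 : ∀ n, 1 ≤ y n := fun n => one_le_pow₀ (by norm_num)
  have hMy : ∀ n, 0 < M (y n)⁻¹ := fun n => hM.pos (inv_pos.2 (hy0 n))
  have hr0 : ∀ n, 0 < r n := fun n => mul_pos (hMy n) (Real.rpow_pos_of_pos (hy0 n) p)
  have ht0 : ∀ n, 0 < t n := fun n => mul_pos (hMy n) (pow_pos (hy0 n) 2)
  -- levels below `s⁻¹` compare with `s` by the monotonicity of the two ratios
  have hr : ∀ s n, 0 < s → 1 ≤ s * y n → r n * s ^ p ≤ M s := fun s n hs hsn => by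
    have := mul_rpow_le_of_powConvex hM hconv (hy0 n) hsn
    rw [Real.mul_rpow hs.le (hy0 n).le] at this
    simp only [r]; linarith
  have ht : ∀ s n, 0 < s → 1 ≤ s * y n → M s ≤ t n * s ^ 2 := fun s n hs hsn => by
    have := le_mul_sq_of_powConcave hM hconc (hy0 n) hsn
    rw [mul_pow] at this
    simp only [t]; linarith
  have hyr : ∀ n, M (y n)⁻¹ = r n * (y n)⁻¹ ^ p := fun n => by
    simp only [r]
    rw [Real.inv_rpow (hy0 n).le, mul_inv_cancel_right₀ (Real.rpow_pos_of_pos (hy0 n) p).ne']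
  have hyt : ∀ n, M (y n)⁻¹ = t n * (y n)⁻¹ ^ 2 := fun n => by
    simp only [t]
    rw [inv_pow, mul_inv_cancel_right₀ (pow_pos (hy0 n) 2).ne']
  have hymono : ∀ {m n}, m ≤ n → y m ≤ y n := fun hmn => pow_le_pow_right₀ (by norm_num) hmn
  have hle1 : ∀ {m n}, m ≤ n → 1 ≤ (y m)⁻¹ * y n := fun {m n} hmn => by
    rw [le_inv_mul_iff₀ (hy0 m), mul_one]; exact hymono hmn
  have hranti : ∀ {m n}, m ≤ n → r n ≤ r m := fun {m n} hmn => by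
    have h3 := hr (y m)⁻¹ n (inv_pos.2 (hy0 m)) (hle1 hmn)
    rw [hyr] at h3
    exact le_of_mul_le_mul_right h3 (Real.rpow_pos_of_pos (inv_pos.2 (hy0 m)) p)
  have htmono : ∀ {m n}, m ≤ n → t m ≤ t n := fun {m n} hmn => by
    have h3 := ht (y m)⁻¹ n (inv_pos.2 (hy0 m)) (hle1 hmn)
    rw [hyt] at h3
    exact le_of_mul_le_mul_right h3 (pow_pos (inv_pos.2 (hy0 m)) 2)
  have hlevel : ∀ s, 0 < s → ∃ n, 1 ≤ s * y n := fun s hs => by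
    obtain ⟨n, hn⟩ := pow_unbounded_of_one_lt s⁻¹ (by norm_num : (1 : ℝ) < 2)
    exact ⟨n, ((inv_lt_iff_one_lt_mul₀' hs).1 hn).le⟩
  have hr_small : ∀ δ, 0 < δ → ∃ n, r n ≤ δ := fun δ hδ => by
    obtain ⟨s, hs, -, hsδ⟩ := h2 δ hδ
    obtain ⟨n, hn⟩ := hlevel s hs
    exact ⟨n, (lt_of_mul_lt_mul_right ((hr s n hs hn).trans_lt hsδ) (by positivity)).le⟩
  have ht_large : ∀ K, ∃ n, K ≤ t n := fun K => by
    obtain ⟨s, hs, -, hsK⟩ := h1 K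
    obtain ⟨n, hn⟩ := hlevel s hs
    exact ⟨n, (lt_of_mul_lt_mul_right (hsK.trans_le (ht s n hs hn)) (by positivity)).le⟩
  have hnext : ∀ n, ∃ m, r m ≤ 1 / 2 * r n ∧ 2 * t n ≤ t m := fun n => by
    obtain ⟨m₁, hm₁⟩ := hr_small (1 / 2 * r n) (by have := hr0 n; positivity)
    obtain ⟨m₂, hm₂⟩ := ht_large (2 * t n)
    exact ⟨max m₁ m₂, (hranti (le_max_left _ _)).trans hm₁, hm₂.trans (htmono (le_max_right _ _))⟩
  let next : ℕ → ℕ := fun n => Nat.find (hnext n)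
  have hspec : ∀ n, r (next n) ≤ 1 / 2 * r n ∧ 2 * t n ≤ t (next n) := fun n =>
    Nat.find_spec (hnext n)
  have hlt : ∀ n, n < next n := fun n => by
    by_contra hle
    have h3 := hranti (not_lt.1 hle)
    have h4 := hspec n
    have := hr0 n
    linarith
  have hfour : ∀ n, r n ≤ 4 * r (next n) ∨ t (next n) ≤ 4 * t n := fun n => by
    obtain ⟨m, hm⟩ : ∃ m, next n = m + 1 := Nat.exists_eq_succ_of_ne_zero (by have := hlt n; omega)
    have h3 := Nat.find_min (hnext n) (show m < Nat.find (hnext n) by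
      change m < next n; omega)
    have hy : y (m + 1) = 2 * y m := pow_succ' 2 m
    have hhalf : 2 * (y (m + 1))⁻¹ = (y m)⁻¹ := by rw [hy]; field_simp
    have hM2 := mul_le_sq_mul hM hconc (A := 2) (s := (y (m + 1))⁻¹) (by norm_num)
      (by have := hy0 (m + 1); positivity)
    have hM1 := hM.two_mul_le (s := (y (m + 1))⁻¹) (by have := hy0 (m + 1); positivity)
    rw [hhalf] at hM1 hM2
    rw [hm]
    by_cases h4 : r m ≤ 1 / 2 * r n
    · right
      have h5 : t m < 2 * t n := not_le.1 fun h5 => h3 ⟨h4, h5⟩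
      have h6 : t (m + 1) ≤ 2 * t m := by
        simp only [t]; rw [hy]
        rw [hy] at hM1
        have := mul_le_mul_of_nonneg_right hM1 (by positivity : 0 ≤ y m ^ 2)
        rw [mul_pow]
        linarith
      linarith
    · left
      have h6 : r m ≤ 2 * r (m + 1) := by
        simp only [r]; rw [hy]
        rw [hy] at hM2
        have h7 : (2 : ℝ) ≤ 2 ^ p := by
          simpa using Real.rpow_le_rpow_of_exponent_le (x := 2) (by norm_num) hp1
        have h8 := Real.rpow_pos_of_pos (hy0 m) p
        have h9 := mul_le_mul_of_nonneg_right hM2 h8.le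
        have h10 : 0 ≤ M (2 * y m)⁻¹ * y m ^ p :=
          mul_nonneg (hM.nonneg (by have := hy0 m; positivity)) h8.le
        rw [Real.mul_rpow (by norm_num) (hy0 m).le]
        have h11 := mul_le_mul_of_nonneg_left h7 h10
        linarith
      linarith
  let N : ℕ → ℕ := fun j => next^[j] 0
  have hN : ∀ j, N (j + 1) = next (N j) := fun j => Function.iterate_succ_apply' next j 0
  have hNge : ∀ j, j ≤ N j := fun j => by
    induction j with
    | zero => exact Nat.zero_le _
    | succ j ih => rw [hN]; exact lt_of_le_of_lt ih (hlt _)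
  refine ⟨fun j => y (N j), ⟨by simp [N, y], fun j => hy1 _, fun K => ?_, fun j => ?_, fun j => ?_⟩,
    fun j => ?_, fun j => ?_⟩
  · obtain ⟨n, hn⟩ := pow_unbounded_of_one_lt K (by norm_num : (1 : ℝ) < 2)
    exact ⟨n, hn.trans_le (hymono (hNge n))⟩
  · simp only [hN]; exact (hspec (N j)).1
  · have := (hspec (N j)).2
    simp only [hN]
    change t (N j) ≤ 1 / 2 * t (next (N j))
    linarith
  · simp only [hN]
    calc 2 * y (N j) = y (N j + 1) := (pow_succ' 2 _).symm
      _ ≤ y (next (N j)) := hymono (hlt _)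
  · simp only [hN]; exact hfour (N j)

/-- The variable taking the values `± x j` with probability proportional to `M (1 / x j)` has a
modular equivalent to `M`, while its distribution function jumps only at the `x j`. If the latter
is equivalent to that of `1 / M⁻¹`, the ratios `x (j + 1) / x j` must be bounded, and a partition
with bounded ratios gives the gap condition. -/
theorem HasUniqueDistribution.powGap (hp1 : 1 ≤ p) (hp2 : p ≤ 2) (hM : IsOrliczFunction M)
    (hconv : IsPowConvex p M) (hconc : IsPowConcave 2 M)
    (hne : ¬ EquivalentOn (Icc 0 1) M fun t => t ^ p) (h : HasUniqueDistribution p M) :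
    PowGap p M (1 / 2) := by
  obtain ⟨x, hx, hx2, hx4⟩ := exists_isGapPartition hp1 hM hconv hconc
    (h.not_le_sq hp1 hp2 hM hconc)
    fun δ hδ => exists_lt_rpow_of_not_equivalentOn hp1 hM hconv hne hδ
  have hx0 : ∀ j, 0 < x j := fun j => by linarith [hx.one_le j]
  have hxmono : Monotone x := monotone_nat_of_le_succ fun j => by linarith [hx2 j, hx0 j]
  let c : ℕ → ℝ := fun j => M (x j)⁻¹
  have hc : ∀ j, 0 < c j := fun j => hM.pos (inv_pos.2 (hx0 j))
  have hup := fun s hs hs1 =>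
    hx.summable_and_tsum_le hp1 hp2 hM hconv hconc (s := s) hs hs1
  have hcsum : Summable c := by
    refine ((hup 1 one_pos le_rfl).1.mul_left (5 / 2)).of_nonneg_of_le (fun j => (hc j).le)
      fun j => ?_
    have := one_le_psi hp1 hp2 (t := 1 * x j)
      (by rw [one_mul, abs_of_pos (hx0 j)]; exact hx.one_le j)
    have := mul_le_mul_of_nonneg_left this (hc j).le
    simp only [c] at this ⊢
    linarith
  set Z := ∑' j, c j with hZ
  have hZ0 : 0 < Z := hcsum.tsum_pos (fun j => (hc j).le) 0 (hc 0)
  let μ : Measure ℝ := Measure.sum fun j => ENNReal.ofReal (c j / Z) • Measure.dirac (x j)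
  have hμ : ∀ g : ℝ → ENNReal, Measurable g →
      ∫⁻ y, g y ∂μ = ∑' j, ENNReal.ofReal (c j / Z) * g (x j) := fun g hg => by
    rw [lintegral_sum_measure]
    refine tsum_congr fun j => ?_
    rw [lintegral_smul_measure, lintegral_dirac, smul_eq_mul]
  have hμreal : ∀ g : ℝ → ℝ, Measurable g → (∀ y, 0 ≤ g y) → Summable (fun j => c j * g (x j)) →
      ∫⁻ y, ENNReal.ofReal (g y) ∂μ = ENNReal.ofReal ((∑' j, c j * g (x j)) / Z) := by
    intro g hg hg0 hs
    rw [hμ _ hg.ennreal_ofReal, ← tsum_div_const,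
      ENNReal.ofReal_tsum_of_nonneg (fun j => div_nonneg (mul_nonneg (hc j).le (hg0 _)) hZ0.le)
        (hs.div_const Z)]
    refine tsum_congr fun j => ?_
    rw [← ENNReal.ofReal_mul (div_nonneg (hc j).le hZ0.le)]
    congr 1; ring
  have : IsProbabilityMeasure μ := ⟨by
    have := hμreal (fun _ => 1) measurable_const (fun _ => zero_le_one) (by simpa using hcsum)
    simpa [← hZ, div_self hZ0.ne'] using this⟩
  obtain ⟨f, F, hfm, hf, hF, hlaw⟩ := exists_indepCopies_of_law hp1 μ (by
    refine lt_of_le_of_lt (lintegral_mono fun y => ENNReal.ofReal_le_ofReal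
      (rpow_le_psi_add_one hp1 y)) ?_
    rw [hμreal (fun y => psi p y + 1) (by have := measurable_psi p; fun_prop)
      (fun y => by linarith [psi_nonneg hp1 y]) ?_]
    · exact ENNReal.ofReal_lt_top
    · have := (hup 1 one_pos le_rfl).1.add hcsum
      simpa [mul_add, c] using this)
  have hmod : ∀ s, 0 < s → s ≤ 1 → modular p f s = (∑' j, c j * psi p (s * x j)) / Z := by
    intro s hs hs1
    have hn : ∀ j, 0 ≤ c j * psi p (s * x j) := fun j => mul_nonneg (hc j).le (psi_nonneg hp1 _)
    rw [modular_of_law hp1 hfm hlaw, hμreal (fun y => psi p (s * y))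
      ((measurable_psi p).comp (measurable_const_mul s)) (fun y => psi_nonneg hp1 _)
      (hup s hs hs1).1, ENNReal.toReal_ofReal (div_nonneg (tsum_nonneg hn) hZ0.le)]
  have hequiv : EquivalentOn (Icc 0 1) M (modular p f) := by
    refine equivalentOn_of_le (k₁ := 1 / (10 * Z)) (k₂ := 4 / Z) (by positivity) (by positivity)
      (fun s hs => hM.nonneg hs.1) (fun s hs => ?_) fun s hs => ?_
    all_goals rcases hs.1.eq_or_lt with rfl | hs0
    · simp [modular, hM.map_zero, psi_zero]
    · rw [hmod s hs0 hs.2, one_div_mul_eq_div, div_le_div_iff₀ (by positivity) hZ0]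
      have hle : ∀ j, c j * psi p (s * x j) ≤ ∑' j, c j * psi p (s * x j) := fun j =>
        (hup s hs0 hs.2).1.le_tsum j fun i _ => mul_nonneg (hc i).le (psi_nonneg hp1 _)
      suffices hs10 : M s ≤ 10 * ∑' j, c j * psi p (s * x j) by
        have := mul_le_mul_of_nonneg_right hs10 hZ0.le
        linarith
      obtain ⟨i, hi1, hi2⟩ := hx.exists_index hs0 hs.2
      rcases hx4 i with h4 | h4
      · have h5 := le_mul_rpow_of_powConvex hM hconv hs0.le (hx0 i) hi1
        have h6 := rpow_le_psi hp1 hp2 (t := s * x (i + 1))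
          (by rw [abs_of_pos (mul_pos hs0 (hx0 _))]; exact hi2.le)
        rw [abs_of_pos (mul_pos hs0 (hx0 _))] at h6
        have h7 := mul_le_mul_of_nonneg_left h6 (hc (i + 1)).le
        rw [Real.mul_rpow hs0.le (hx0 _).le] at h5 h7
        have h8 := mul_le_mul_of_nonneg_left h4 (by positivity : 0 ≤ s ^ p)
        have h9 := hle (i + 1)
        simp only [c] at h7 h9 ⊢
        linarith
      · have h5 := le_mul_sq_of_powConcave hM hconc (hx0 (i + 1)) hi2.le
        have h6 := sq_le_psi hp1 hp2 (t := s * x i)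
          (by rw [abs_of_pos (mul_pos hs0 (hx0 _))]; exact hi1)
        have h7 := mul_le_mul_of_nonneg_left h6 (hc i).le
        rw [mul_pow] at h5 h7
        have h8 := mul_le_mul_of_nonneg_left h4 (by positivity : 0 ≤ s ^ 2)
        have h9 := hle i
        simp only [c] at h7 h9 ⊢
        linarith
    · simp [modular, hM.map_zero, psi_zero]
    · rw [hmod s hs0 hs.2, div_mul_eq_mul_div]
      have := (hup s hs0 hs.2).2
      gcongr
  obtain ⟨τ₀, -, C, hC, hle⟩ := h f F hf hF
    (equivUnitVectorBasis_of_equivalentOn hp1 hp2 hM hf hF hequiv)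
  have hdist : ∀ j, distrFun f (x (j + 1) / 2) = distrFun f (x j) := by
    -- no value of `|f|` lies in the half-open interval between the two levels
    intro j
    have h1 : ∀ τ, volume {u | τ < |f u|}
        = ∑' i, ENNReal.ofReal (c i / Z) * (Ioi τ).indicator 1 |x i| := fun τ => by
      have hm : Measurable ((Ioi τ).indicator (1 : ℝ → ENNReal)) :=
        measurable_one.indicator measurableSet_Ioi
      rw [← hμ (fun y => (Ioi τ).indicator 1 |y|) (hm.comp measurable_abs), ← hlaw _ hm,
        ← lintegral_indicator_one (measurableSet_lt measurable_const hfm.abs)]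
      rfl
    rw [distrFun, distrFun, Measure.real, Measure.real, h1, h1]
    congr 2
    funext i
    congr 1
    have hiff : |x i| ∈ Ioi (x (j + 1) / 2) ↔ |x i| ∈ Ioi (x j) := by
      rw [abs_of_pos (hx0 i), mem_Ioi, mem_Ioi]
      rcases le_or_gt i j with hij | hij
      · have h2 := hxmono hij
        have h3 := hx2 j
        constructor <;> intro <;> linarith
      · have h2 : x (j + 1) ≤ x i := hxmono hij
        have h3 := hx2 j
        have h4 := hx0 (j + 1)
        have h5 := hx0 j
        constructor <;> intro <;> linarith
    simp only [indicator_apply, hiff]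
  obtain ⟨j₀, hj₀⟩ := hx.unbounded τ₀
  -- beyond `τ₀` consecutive levels are comparable
  have hratio : ∀ j, j₀ ≤ j → x (j + 1) ≤ 4 * C ^ 2 * x j := by
    intro j hj
    have hτj : τ₀ ≤ x j := hj₀.le.trans (hxmono hj)
    have hxj : x j ≤ x (j + 1) / 2 := by linarith [hx2 j]
    have h1 := (hle (x j) hτj).2
    have h2 := (inv_mul_le_iff₀ hC).1 (hle (x (j + 1) / 2) (hτj.trans hxj)).1
    rw [distrFun_invRecip hM (hx.one_le j)] at h1
    rw [distrFun_invRecip hM ((hx.one_le j).trans hxj), hdist j, inv_div,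
      div_eq_mul_inv] at h2
    have h3 := mul_le_sq_mul hM hconc (A := 2) (s := (x (j + 1))⁻¹) (by norm_num)
      (by have := hx0 (j + 1); positivity)
    have h4 : M (x j)⁻¹ ≤ 4 * C ^ 2 * M (x (j + 1))⁻¹ := by
      have h5 := h1.trans (mul_le_mul_of_nonneg_left h2 hC.le)
      have h6 := mul_le_mul_of_nonneg_left h3 (by positivity : 0 ≤ C * C)
      linarith
    have hle1 : x j * (x (j + 1))⁻¹ ≤ 1 := by
      rw [← div_eq_mul_inv, div_le_one (hx0 _)]; linarith [hx0 (j + 1)]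
    have h5 := hM.le_mul (l := x j * (x (j + 1))⁻¹) (t := (x j)⁻¹)
      (by have := hx0 j; have := hx0 (j + 1); positivity) hle1 (by have := hx0 j; positivity)
    rw [show x j * (x (j + 1))⁻¹ * (x j)⁻¹ = (x (j + 1))⁻¹ by have := hx0 j; field_simp] at h5
    have h6 : M (x (j + 1))⁻¹ ≤ x j * (x (j + 1))⁻¹ * (4 * C ^ 2) * M (x (j + 1))⁻¹ :=
      h5.trans (by
        rw [mul_assoc _ (4 * C ^ 2)]
        exact mul_le_mul_of_nonneg_left h4
          (by have := hx0 j; have := hx0 (j + 1); positivity))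
    have h7 : 1 ≤ x j * (x (j + 1))⁻¹ * (4 * C ^ 2) := by
      refine le_of_mul_le_mul_right (a := M (x (j + 1))⁻¹) ?_ (hc (j + 1))
      linarith
    rw [← div_eq_mul_inv, div_mul_eq_mul_div, le_div_iff₀ (hx0 _)] at h7
    linarith
  -- the summand `x j₀` takes care of the finitely many levels below `τ₀`
  set B := 4 * C ^ 2 + x j₀ with hB
  have hB1 : 1 ≤ B := by
    have := hx.one_le j₀
    have : 0 ≤ 4 * C ^ 2 := by positivity
    linarith
  have hxB : ∀ j, x (j + 1) ≤ B * x j := by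
    intro j
    have h1 := hx.one_le j
    have h2 := hx0 j₀
    have h3 : 0 ≤ 4 * C ^ 2 := by positivity
    rcases lt_or_ge j j₀ with hj | hj
    · have h4 : x (j + 1) ≤ x j₀ := hxmono hj
      nlinarith
    · have h4 := hratio j hj
      nlinarith
  have hBone : 1 < B := by
    have h1 := hx2 0
    have h2 := hxB 0
    rw [hx.zero] at h1 h2
    linarith
  refine ⟨B ^ 2, one_lt_pow₀ hBone two_ne_zero, fun s hs hs1 => ?_⟩
  set t := B ^ 2 * s with ht
  have hB0 : 0 < B := by linarith
  have ht0 : 0 < t := by positivity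
  -- the levels `x (i + 1)` and `x (i + 2)` separate `1 / t` from `1 / s`
  obtain ⟨i, hi1, hi2⟩ := hx.exists_index ht0 hs1
  have hsi : s * x (i + 1 + 1) ≤ 1 := by
    refine le_trans ?_ hi1
    have h1 := hxB (i + 1)
    have h2 := mul_le_mul_of_nonneg_left (hxB i) hB0.le
    have h3 := mul_le_mul_of_nonneg_left (h1.trans h2) hs.le
    rw [ht]
    linarith
  constructor
  · have h1 := le_mul_rpow_of_powConvex hM hconv hs.le (hx0 _) hsi
    have h2 := mul_rpow_le_of_powConvex hM hconv (hx0 _) hi2.le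
    have h3 := mul_le_mul_of_nonneg_left (hx.halve (i + 1)) (by positivity : 0 ≤ s ^ p)
    rw [Real.mul_rpow hs.le (hx0 _).le] at h1
    have h4 : t ^ p = (B ^ 2) ^ p * s ^ p := Real.mul_rpow (by positivity) hs.le
    rw [Real.mul_rpow ht0.le (hx0 _).le, h4] at h2
    have h5 : M s ≤ 1 / 2 * (s ^ p * (M (x (i + 1))⁻¹ * x (i + 1) ^ p)) := by linarith
    have h6 := mul_le_mul_of_nonneg_left h5 (by positivity : 0 ≤ (B ^ 2) ^ p)
    linarith
  · have h1 := mul_sq_le_of_powConcave hM hconc hs.le (hx0 _) hsi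
    have h2 := le_mul_sq_of_powConcave hM hconc (hx0 _) hi2.le
    have h3 := mul_le_mul_of_nonneg_left (hx.double (i + 1)) (by positivity : 0 ≤ s ^ 2)
    rw [mul_pow] at h1 h2
    have h4 : t ^ 2 = (B ^ 2) ^ 2 * s ^ 2 := by rw [ht, mul_pow]
    rw [h4] at h2
    have h5 : s ^ 2 * (M (x (i + 1))⁻¹ * x (i + 1) ^ 2) ≤ 1 / 2 * M s := by linarith
    have h6 := mul_le_mul_of_nonneg_left h5 (by positivity : 0 ≤ (B ^ 2) ^ 2)
    linarith
end

theorem theorem1 (p : ℝ) (hp1 : 1 ≤ p) (hp2 : p < 2) (M : ℝ → ℝ) (hM : IsOrliczFunction M)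
    (hconv : IsPowConvex p M) (hconc : IsPowConcave 2 M) :
    (¬ EquivalentOn (Set.Icc 0 1) M (fun t => t ^ p) →
      List.TFAE [IsStrictlyBetween p M, HasUniqueDistribution p M, InvRecipSpans p M]) ∧
    (IsStrictlyBetween p M ↔ InvRecipSpans p M) := by
  have h13 : IsStrictlyBetween p M ↔ InvRecipSpans p M :=
    ⟨fun h => (h.powGap hM (by norm_num)).invRecipSpans hp1 hp2.le hM hconv hconc,
      fun h => (h.powGap hp1 hp2.le hM hconv hconc).isStrictlyBetween hp1 hM hconc⟩
  refine ⟨fun hne => ?_, h13⟩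
  tfae_have 1 ↔ 3 := h13
  tfae_have 1 → 2 := fun h =>
    hasUniqueDistribution_of_powGap hp1 hp2.le hM hconc fun η hη => h.powGap hM hη
  tfae_have 2 → 1 := fun h =>
    (h.powGap hp1 hp2.le hM hconv hconc hne).isStrictlyBetween hp1 hM hconc
  tfae_finish
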